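/- Let $\mathbb{Z}^2$ denote the square lattice graph: its vertices are the points of $\mathbb{Z}^2$, and two points are adjacent if and only if their $\ell^1$-distance is $1$. Let $G$ be a connected, locally finite simple graph that is a finite modification of $\mathbb{Z}^2$; that is, there are finite sets $D \subset \mathbb{Z}^2$ and $D' \subset V(G)$ such that the subgraph of $\mathbb{Z}^2$ induced on $\mathbb{Z}^2 \setminus D$ is isomorphic to the subgraph of $G$ induced on $V(G) \setminus D'$. Let $o$ be any vertex of $G$, and let $(S_n)_{n \ge 0}$ be the simple random walk on $G$ started at $o$; that is, under its law $P^o$ it is the Markov chain with $S_0 = o$ almost surely and with one-step transition probabilities $1/\deg(x)$ from $x$ to each neighbour of $x$ (and $0$ to every other vertex). Let $R_n = |\{S_0, S_1, \dots, S_n\}|$ be the number of distinct vertices visited up to time $n$, and let $E^o$ denote expectation under $P^o$. Then $$\lim_{n \to \infty} \frac{\log n}{n}\, E^o[R_n] = \pi .$$ -/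

import Mathlib

open MeasureTheory ProbabilityTheory Filter Topology
open scoped ENNReal

/-- The square lattice `ℤ²`: two points are adjacent iff their `ℓ¹`-distance is `1`. -/
def squareLattice : SimpleGraph (ℤ × ℤ) where
  Adj x y := |x.1 - y.1| + |x.2 - y.2| = 1
  symm := ⟨fun x y h => by rw [abs_sub_comm y.1, abs_sub_comm y.2]; exact h⟩
  loopless := ⟨fun x h => by simp at h⟩

/-- `G'` is a finite modification of `G`: after deletion of a finite set of vertices from each of
the two graphs, the remaining induced subgraphs are isomorphic. -/
def IsFiniteModification {V' V : Type*} (G' : SimpleGraph V') (G : SimpleGraph V) : Prop :=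
  ∃ (D : Set V) (D' : Set V'), D.Finite ∧ D'.Finite ∧
    Nonempty (G.induce Dᶜ ≃g G'.induce D'ᶜ)

open Classical in
/-- One-step transition probabilities of the simple random walk: `1 / deg v` for each neighbour
of `v`, and `0` for every other vertex. -/
noncomputable def stepProb {V : Type*} (G : SimpleGraph V) [G.LocallyFinite] (v w : V) : ℝ≥0∞ :=
  if G.Adj v w then (G.degree v : ℝ≥0∞)⁻¹ else 0

/-- The process `S` is, under the law `P`, a simple random walk on `G` started at `o`: `S 0 = o`
almost surely and, whatever the trajectory `x 0, …, x n` up to time `n`, the conditional probability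
of `S (n + 1) = y` is `stepProb G (x n) y`. -/
structure IsSimpleRandomWalk {V : Type*} (G : SimpleGraph V) [G.LocallyFinite] (o : V)
    {Ω : Type*} [MeasurableSpace Ω] (P : Measure Ω) (S : ℕ → Ω → V) : Prop where
  measurable : ∀ n, @Measurable Ω V _ ⊤ (S n)
  start : P {ω | S 0 ω = o} = 1
  markov : ∀ (n : ℕ) (x : ℕ → V) (y : V),
    P {ω | (∀ i ≤ n, S i ω = x i) ∧ S (n + 1) ω = y} =
      P {ω | ∀ i ≤ n, S i ω = x i} * stepProb G (x n) y

/-- The range `R_n = |{S_0, …, S_n}|`. -/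
noncomputable def walkRange {V Ω : Type*} (S : ℕ → Ω → V) (n : ℕ) (ω : Ω) : ℕ :=
  ((fun i => S i ω) '' Set.Iic n).ncard

/-- The simple random walk exists on every countable locally finite graph without isolated
vertices; it is realised by the coordinate process on the space of trajectories. -/
theorem exists_isSimpleRandomWalk {V : Type*} [Countable V] (G : SimpleGraph V) [G.LocallyFinite]
    (hG : ∀ v, 0 < G.degree v) (o : V) :
    ∃ (_ : MeasurableSpace (ℕ → V)) (P : Measure (ℕ → V)),
      IsProbabilityMeasure P ∧ IsSimpleRandomWalk G o P (fun n x => x n) := by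
  let _ : MeasurableSpace V := ⊤
  have : DiscreteMeasurableSpace V := ⟨fun _ => trivial⟩
  have hne : ∀ v, (G.neighborFinset v).Nonempty := fun v => Finset.card_pos.1 (by simpa using hG v)
  let κ : Kernel V V :=
    ⟨fun v => (PMF.uniformOfFinset (G.neighborFinset v) (hne v)).toMeasure, measurable_from_top⟩
  have : IsMarkovKernel κ := ⟨fun v => PMF.toMeasure.isProbabilityMeasure _⟩
  have hκ : ∀ v y, κ v {y} = stepProb G v y := by
    intro v y
    change (PMF.uniformOfFinset (G.neighborFinset v) (hne v)).toMeasure {y} = _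
    rw [PMF.toMeasure_apply_singleton _ _ (MeasurableSet.singleton y), PMF.uniformOfFinset_apply]
    have hiff : y ∈ G.neighborFinset v ↔ G.Adj v y := by simp
    by_cases hy : G.Adj v y
    · rw [if_pos (hiff.2 hy), stepProb, if_pos hy, SimpleGraph.card_neighborFinset_eq_degree]
    · rw [if_neg (fun h => hy (hiff.1 h)), stepProb, if_neg hy]
  let η : (n : ℕ) → Kernel ((i : Finset.Iic n) → V) V := fun n =>
    κ.comap (fun h => h ⟨n, by simp⟩) (measurable_pi_apply _)
  have : ∀ n, IsMarkovKernel (η n) := fun n => inferInstance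
  let P : Measure (ℕ → V) := Kernel.traj (X := fun _ => V) η 0 (fun _ => o)
  have hP : IsProbabilityMeasure P := inferInstance
  refine ⟨inferInstance, P, hP, fun n => measurable_pi_apply n, ?_, ?_⟩
  · have h := congrArg (fun μ => μ {x | x ⟨0, by simp⟩ = o})
      (Kernel.traj_map_frestrictLe_apply (X := fun _ => V) (κ := η) 0 0 (fun _ => o))
    have hm : MeasurableSet {x : (i : Finset.Iic 0) → V | x ⟨0, by simp⟩ = o} :=
      measurableSet_eq_fun (measurable_pi_apply _) measurable_const
    simp only [Kernel.partialTraj_self] at h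
    rw [Measure.map_apply (by fun_prop) hm, Kernel.id_apply, Measure.dirac_apply' _ hm] at h
    simpa using h
  · intro n x y
    have hm : MeasurableSet ({Preorder.frestrictLe (π := fun _ => V) n x} :
      Set ((i : Finset.Iic n) → V)) := MeasurableSet.singleton _
    have hy : MeasurableSet ({y} : Set V) := MeasurableSet.singleton y
    have key : (P.map (Preorder.frestrictLe (π := fun _ => V) n)) ⊗ₘ η n =
        P.map (fun x => (Preorder.frestrictLe n x, x (n + 1))) := by
      have h0 := Kernel.partialTraj_compProd_eq_map_traj (X := fun _ => V) (κ := η)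
        (Nat.zero_le n) (x₀ := fun _ => o)
      rw [← Kernel.traj_map_frestrictLe_apply] at h0
      exact h0
    have h := congrArg (fun μ => μ ({Preorder.frestrictLe (π := fun _ => V) n x} ×ˢ {y})) key
    rw [Measure.compProd_apply_prod hm hy, Measure.map_apply (by fun_prop) (hm.prod hy),
      lintegral_singleton, Measure.map_apply (by fun_prop) hm] at h
    have e1 : ∀ w : ℕ → V, Preorder.frestrictLe (π := fun _ => V) n w =
        Preorder.frestrictLe (π := fun _ => V) n x ↔ ∀ i ≤ n, w i = x i := by
      intro w
      simp [funext_iff]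
    have e2 : η n (Preorder.frestrictLe (π := fun _ => V) n x) {y} = stepProb G (x n) y := hκ _ _
    rw [e2, mul_comm] at h
    have e3 : {w : ℕ → V | (∀ i ≤ n, w i = x i) ∧ w (n + 1) = y} =
        (fun w => (Preorder.frestrictLe (π := fun _ => V) n w, w (n + 1))) ⁻¹'
          ({Preorder.frestrictLe (π := fun _ => V) n x} ×ˢ {y}) := by
      ext w
      simp only [Set.mem_preimage, Set.mem_prod, Set.mem_singleton_iff, e1, Set.mem_ofPred_eq]
    have e4 : {w : ℕ → V | ∀ i ≤ n, w i = x i} =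
        Preorder.frestrictLe (π := fun _ => V) n ⁻¹'
          {Preorder.frestrictLe (π := fun _ => V) n x} := by
      ext w
      simp only [Set.mem_preimage, Set.mem_singleton_iff, e1, Set.mem_ofPred_eq]
    rw [e3, e4, ← h]

/-! By linearity E[R_n] is the sum over y of the probability p_n(o,y) of visiting y by time n
(`IsSimpleRandomWalk.integral_walkRange`). Let g_n(x,y) be the expected number of visits. Splitting
at the first visit gives p_n(o,y) g_m(y,y) ≤ g_{n+m}(o,y) and g_n(o,y) ≤ p_n(o,y) g_n(y,y). On the
lattice g_n(y,y) = L_n is independent of y, L_n ~ log n / π, and the g_n(o,y) sum to n + 1. Hence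
E[R_n] ~ π n / log n, on choosing m = o(n) with log m ~ log n in the upper bound.

On G the diagonal g_n(y,y) depends on y, and it must be close to L_n for most y. Outside a finite
set A the two Green functions obey the same first-step recursion. A maximum principle therefore
bounds their difference by their values from A, and then by K B(y), where B(y) is the lattice Green
function between y and 0 at time n + d. The same K B(y) bounds g_n(o,y) on G
(`Overlap.exists_comparison`). Replacing g(y,y) by L thus costs O(B(y)²/L²) at each y. By
Chapman–Kolmogorov and the O(1/k) return probabilities of the lattice, the B(y)² sum to O(n)
(`tsum_sq_green_le`), so the total error is O(n / log² n).

The a priori input on G is g_n(o,o) = O(L_n) (`Overlap.exists_green_self_le`). If it failed, the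
maximum principle would put a large multiple of the lattice Green function below that of G,
contradicting that both have total mass of order n. -/

/-! ### Green functions and hitting probabilities on a locally finite graph. -/

section Graph

variable {V : Type*} (G : SimpleGraph V) [G.LocallyFinite]

/-- The mean of `f` over the neighbours of `x`. -/
noncomputable def nbrMean (f : V → ℝ) (x : V) : ℝ :=
  (∑ y ∈ G.neighborFinset x, f y) / G.degree x

open Classical in
/-- The `n`-step transition probabilities of the simple random walk. -/
noncomputable def heat : ℕ → V → V → ℝ
  | 0, x, y => if x = y then 1 else 0
  | n + 1, x, y => nbrMean G (fun z => heat n z y) x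

/-- The Green function up to time `n`: the expected number of visits to `y` from `x`. -/
noncomputable def green (n : ℕ) (x y : V) : ℝ := ∑ k ∈ Finset.range (n + 1), heat G k x y

open Classical in
/-- The probability that the simple random walk from `x` visits `y` up to time `n`. -/
noncomputable def hitProb : ℕ → V → V → ℝ
  | 0, x, y => if x = y then 1 else 0
  | n + 1, x, y => if x = y then 1 else nbrMean G (fun z => hitProb n z y) x

variable {G}

theorem nbrMean_mono {f g : V → ℝ} (h : ∀ x, f x ≤ g x) (x : V) :
    nbrMean G f x ≤ nbrMean G g x := by
  unfold nbrMean
  gcongr with y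
  exact h y

theorem nbrMean_nonneg {f : V → ℝ} (h : ∀ x, 0 ≤ f x) (x : V) : 0 ≤ nbrMean G f x :=
  div_nonneg (Finset.sum_nonneg fun y _ => h y) (Nat.cast_nonneg _)

theorem nbrMean_mul_const (f : V → ℝ) (c : ℝ) (x : V) :
    nbrMean G (fun z => f z * c) x = nbrMean G f x * c := by
  unfold nbrMean
  rw [← Finset.sum_mul]
  ring

theorem nbrMean_add (f g : V → ℝ) (x : V) :
    nbrMean G (fun z => f z + g z) x = nbrMean G f x + nbrMean G g x := by
  unfold nbrMean
  rw [Finset.sum_add_distrib, add_div]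

theorem nbrMean_sum {ι : Type*} (s : Finset ι) (f : ι → V → ℝ) (x : V) :
    nbrMean G (fun z => ∑ i ∈ s, f i z) x = ∑ i ∈ s, nbrMean G (f i) x := by
  unfold nbrMean
  rw [Finset.sum_comm, Finset.sum_div]

theorem nbrMean_const_le {c : ℝ} (hc : 0 ≤ c) (x : V) : nbrMean G (fun _ => c) x ≤ c := by
  unfold nbrMean
  rw [Finset.sum_const, SimpleGraph.card_neighborFinset_eq_degree, nsmul_eq_mul]
  rcases Nat.eq_zero_or_pos (G.degree x) with h | h
  · simpa [h] using hc
  · have : (0 : ℝ) < G.degree x := Nat.cast_pos.2 h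
    rw [mul_div_cancel_left₀ _ this.ne']

theorem nbrMean_const {x : V} (hx : 0 < G.degree x) (c : ℝ) : nbrMean G (fun _ => c) x = c := by
  unfold nbrMean
  rw [Finset.sum_const, SimpleGraph.card_neighborFinset_eq_degree, nsmul_eq_mul,
    mul_div_cancel_left₀ _ (Nat.cast_pos.2 hx).ne']

theorem hasSum_nbrMean {ι : Type*} {f : ι → V → ℝ} {g : V → ℝ} (h : ∀ z, HasSum (fun i => f i z) (g z))
    (x : V) : HasSum (fun i => nbrMean G (f i) x) (nbrMean G g x) :=
  (hasSum_sum fun z _ => h z).div_const _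

theorem heat_nonneg (n : ℕ) (x y : V) : 0 ≤ heat G n x y := by
  induction n generalizing x with
  | zero => unfold heat; split_ifs <;> norm_num
  | succ n ih => exact nbrMean_nonneg (fun z => ih z) x

theorem heat_zero_self (x : V) : heat G 0 x x = 1 := by simp [heat]

theorem heat_zero_of_ne {x y : V} (h : x ≠ y) : heat G 0 x y = 0 := by simp [heat, h]

theorem heat_succ (n : ℕ) (x y : V) :
    heat G (n + 1) x y = nbrMean G (fun z => heat G n z y) x := rfl

theorem green_nonneg (n : ℕ) (x y : V) : 0 ≤ green G n x y :=
  Finset.sum_nonneg fun _ _ => heat_nonneg _ _ _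

theorem green_zero (x y : V) : green G 0 x y = heat G 0 x y := by simp [green]

theorem green_succ (n : ℕ) (x y : V) :
    green G (n + 1) x y = heat G 0 x y + nbrMean G (fun z => green G n z y) x := by
  unfold green
  rw [Finset.sum_range_succ', nbrMean_sum, add_comm]
  rfl

theorem nbrMean_green_le (n : ℕ) (x y : V) :
    nbrMean G (fun z => green G n z y) x ≤ green G (n + 1) x y := by
  rw [green_succ]
  exact le_add_of_nonneg_left (heat_nonneg _ _ _)

theorem green_succ_of_ne (n : ℕ) {x y : V} (h : x ≠ y) :
    green G (n + 1) x y = nbrMean G (fun z => green G n z y) x := by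
  rw [green_succ, heat_zero_of_ne h, zero_add]

theorem green_mono {m n : ℕ} (h : m ≤ n) (x y : V) : green G m x y ≤ green G n x y :=
  Finset.sum_le_sum_of_subset_of_nonneg (Finset.range_mono (by omega))
    fun _ _ _ => heat_nonneg _ _ _

theorem one_le_green_self (n : ℕ) (x : V) : 1 ≤ green G n x x := by
  rw [← heat_zero_self (G := G) x, ← green_zero]
  exact green_mono (Nat.zero_le n) x x

theorem green_self_pos (n : ℕ) (x : V) : 0 < green G n x x :=
  one_pos.trans_le (one_le_green_self n x)

theorem green_le_green_self (n : ℕ) (x y : V) : green G n x y ≤ green G n y y := by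
  induction n generalizing x with
  | zero =>
    rcases eq_or_ne x y with rfl | h
    · exact le_rfl
    · rw [green_zero, heat_zero_of_ne h]
      exact green_nonneg _ _ _
  | succ n ih =>
    rcases eq_or_ne x y with rfl | h
    · exact le_rfl
    · rw [green_succ_of_ne n h]
      exact ((nbrMean_mono ih x).trans (nbrMean_const_le (green_nonneg _ _ _) x)).trans
        (green_mono n.le_succ y y)

theorem heat_le_one (n : ℕ) (x y : V) : heat G n x y ≤ 1 := by
  induction n generalizing x with
  | zero => unfold heat; split_ifs <;> norm_num
  | succ n ih => exact (nbrMean_mono ih x).trans (nbrMean_const_le zero_le_one x)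

theorem green_le (n : ℕ) (x y : V) : green G n x y ≤ n + 1 := by
  refine (Finset.sum_le_sum fun k _ => heat_le_one k x y).trans ?_
  simp

theorem heat_mul_heat_le (j k : ℕ) (x y z : V) :
    heat G j x y * heat G k y z ≤ heat G (j + k) x z := by
  induction j generalizing x with
  | zero =>
    rcases eq_or_ne x y with rfl | h
    · rw [heat_zero_self, one_mul, zero_add]
    · rw [heat_zero_of_ne h, zero_mul]
      exact heat_nonneg _ _ _
  | succ j ih =>
    rw [heat_succ, ← nbrMean_mul_const, Nat.succ_add, heat_succ]
    exact nbrMean_mono ih x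

theorem green_mul_heat_le (n d : ℕ) (x y z : V) :
    green G n x y * heat G d y z ≤ green G (n + d) x z := by
  induction n generalizing x with
  | zero =>
    rw [green_zero, zero_add]
    refine (heat_mul_heat_le 0 d x y z).trans ?_
    rw [zero_add]
    exact Finset.single_le_sum (f := fun k => heat G k x z) (fun k _ => heat_nonneg k x z)
      (Finset.self_mem_range_succ d)
  | succ n ih =>
    unfold green at ih ⊢
    rw [Finset.sum_range_succ, add_mul, Nat.succ_add, Finset.sum_range_succ _ (n + d + 1)]
    refine add_le_add (ih x) ((heat_mul_heat_le _ _ _ _ _).trans_eq ?_)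
    rw [Nat.add_right_comm]

theorem heat_mul_green_le (d n : ℕ) (x y z : V) :
    heat G d x y * green G n y z ≤ green G (d + n) x z := by
  induction d generalizing x with
  | zero =>
    rcases eq_or_ne x y with rfl | h
    · rw [heat_zero_self, one_mul, zero_add]
    · rw [heat_zero_of_ne h, zero_mul]
      exact green_nonneg _ _ _
  | succ d ih =>
    rw [heat_succ, ← nbrMean_mul_const, Nat.succ_add]
    exact (nbrMean_mono ih x).trans (nbrMean_green_le _ _ _)

theorem hitProb_nonneg (n : ℕ) (x y : V) : 0 ≤ hitProb G n x y := by
  induction n generalizing x with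
  | zero => unfold hitProb; split_ifs <;> norm_num
  | succ n ih =>
    unfold hitProb
    split_ifs
    · exact zero_le_one
    · exact nbrMean_nonneg (fun z => ih z) x

theorem hitProb_le_one (n : ℕ) (x y : V) : hitProb G n x y ≤ 1 := by
  induction n generalizing x with
  | zero => unfold hitProb; split_ifs <;> norm_num
  | succ n ih =>
    unfold hitProb
    split_ifs
    · exact le_rfl
    · exact (nbrMean_mono ih x).trans (nbrMean_const_le zero_le_one x)

theorem hitProb_self (n : ℕ) (x : V) : hitProb G n x x = 1 := by cases n <;> simp [hitProb]

theorem hitProb_zero_of_ne {x y : V} (h : x ≠ y) : hitProb G 0 x y = 0 := by simp [hitProb, h]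

theorem hitProb_succ_of_ne (n : ℕ) {x y : V} (h : x ≠ y) :
    hitProb G (n + 1) x y = nbrMean G (fun z => hitProb G n z y) x := by simp [hitProb, h]

/-- After the first visit to y at most n steps remain, so the expected number of visits from then on
is at most `green G n y y`. -/
theorem green_le_hitProb_mul (n : ℕ) (x y : V) :
    green G n x y ≤ hitProb G n x y * green G n y y := by
  induction n generalizing x with
  | zero =>
    rcases eq_or_ne x y with rfl | h
    · rw [hitProb_self, one_mul]
    · rw [hitProb_zero_of_ne h, green_zero, heat_zero_of_ne h, zero_mul]
  | succ n ih =>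
    rcases eq_or_ne x y with rfl | h
    · rw [hitProb_self, one_mul]
    · rw [green_succ_of_ne n h, hitProb_succ_of_ne n h, ← nbrMean_mul_const]
      refine nbrMean_mono (fun z => (ih z).trans ?_) x
      exact mul_le_mul_of_nonneg_left (green_mono n.le_succ y y) (hitProb_nonneg _ _ _)

/-- If y is hit by time n, at least m of the n + m steps remain after the hit. The extra time m is
what makes a lower bound on the remaining visits available. -/
theorem hitProb_mul_green_le (n m : ℕ) (x y : V) :
    hitProb G n x y * green G m y y ≤ green G (n + m) x y := by
  induction n generalizing x with
  | zero =>
    rcases eq_or_ne x y with rfl | h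
    · rw [hitProb_self, one_mul, zero_add]
    · rw [hitProb_zero_of_ne h, zero_mul]
      exact green_nonneg _ _ _
  | succ n ih =>
    rcases eq_or_ne x y with rfl | h
    · rw [hitProb_self, one_mul]
      exact green_mono (by omega) x x
    · rw [hitProb_succ_of_ne n h, ← nbrMean_mul_const, Nat.succ_add]
      exact (nbrMean_mono ih x).trans (nbrMean_green_le _ _ _)

theorem hitProb_le_green (n : ℕ) (x y : V) : hitProb G n x y ≤ green G n x y := by
  have h := hitProb_mul_green_le (G := G) n 0 x y
  rwa [green_zero, heat_zero_self, mul_one] at h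

theorem hasSum_heat (hG : ∀ v, 0 < G.degree v) (n : ℕ) (x : V) :
    HasSum (fun y => heat G n x y) 1 := by
  induction n generalizing x with
  | zero =>
    rw [← heat_zero_self (G := G) x]
    exact hasSum_single x fun y hy => heat_zero_of_ne hy.symm
  | succ n ih =>
    have h := hasSum_nbrMean (G := G) ih x
    rwa [nbrMean_const (hG x)] at h

theorem hasSum_green (hG : ∀ v, 0 < G.degree v) (n : ℕ) (x : V) :
    HasSum (fun y => green G n x y) (n + 1) := by
  have h := hasSum_sum (s := Finset.range (n + 1)) fun k _ => hasSum_heat hG k x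
  simpa [green] using h

theorem hasSum_heat_mul_heat (j k : ℕ) (x y : V) :
    HasSum (fun z => heat G j x z * heat G k z y) (heat G (j + k) x y) := by
  induction j generalizing x with
  | zero =>
    have h := hasSum_single (f := fun z => heat G 0 x z * heat G k z y) x
      fun z hz => by rw [heat_zero_of_ne hz.symm, zero_mul]
    rw [heat_zero_self, one_mul] at h
    rwa [zero_add]
  | succ j ih =>
    have h := hasSum_nbrMean (G := G) ih x
    simp only [nbrMean_mul_const] at h
    rw [Nat.succ_add]
    exact h

/-- Decomposition at the last step, where `heat` is defined by the first; reversibility pairs the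
two. -/
theorem heat_succ_right (n : ℕ) (x y : V) :
    heat G (n + 1) x y = ∑ z ∈ G.neighborFinset y, heat G n x z / G.degree z := by
  classical
  induction n generalizing x with
  | zero =>
    rw [heat_succ, nbrMean]
    have h1 : ∑ z ∈ G.neighborFinset x, heat G 0 z y = if G.Adj x y then 1 else 0 := by
      simp [heat]
    have h2 : ∑ z ∈ G.neighborFinset y, heat G 0 x z / G.degree z =
        if G.Adj x y then (1 : ℝ) / G.degree x else 0 := by
      have : ∀ z, heat G 0 x z / G.degree z = if x = z then (1 : ℝ) / G.degree x else 0 := by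
        intro z
        unfold heat
        split_ifs with h
        · rw [h]
        · rw [zero_div]
      simp only [this, Finset.sum_ite_eq, SimpleGraph.mem_neighborFinset, G.adj_comm y x]
    rw [h1, h2]
    split_ifs
    · rfl
    · rw [zero_div]
  | succ n ih =>
    rw [heat_succ]
    simp only [ih, nbrMean_sum]
    refine Finset.sum_congr rfl fun z _ => ?_
    simp only [div_eq_mul_inv, nbrMean_mul_const]
    rfl

/-- Reversibility of the walk with respect to the degree measure. -/
theorem degree_mul_heat (hG : ∀ v, 0 < G.degree v) (n : ℕ) (x y : V) :
    G.degree x * heat G n x y = G.degree y * heat G n y x := by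
  have hne : ∀ v, (G.degree v : ℝ) ≠ 0 := fun v => (Nat.cast_pos.2 (hG v)).ne'
  induction n generalizing x y with
  | zero =>
    rcases eq_or_ne x y with rfl | h
    · rfl
    · rw [heat_zero_of_ne h, heat_zero_of_ne h.symm, mul_zero, mul_zero]
  | succ n ih =>
    rw [heat_succ_right n y x, heat_succ, nbrMean, mul_div_cancel₀ _ (hne x), Finset.mul_sum]
    refine Finset.sum_congr rfl fun z _ => ?_
    rw [← mul_div_assoc, ih y z, mul_div_cancel_left₀ _ (hne z)]

theorem degree_mul_green (hG : ∀ v, 0 < G.degree v) (n : ℕ) (x y : V) :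
    G.degree x * green G n x y = G.degree y * green G n y x := by
  simp only [green, Finset.mul_sum, degree_mul_heat hG]

theorem green_le_degree_mul (hG : ∀ v, 0 < G.degree v) (n : ℕ) (x y : V) :
    green G n x y ≤ G.degree y * green G n y x := by
  rw [← degree_mul_green hG]
  exact le_mul_of_one_le_left (green_nonneg _ _ _) (Nat.one_le_cast.2 (hG x))

theorem exists_heat_pos (hG : G.Connected) (x y : V) : ∃ d, 0 < heat G d x y := by
  obtain ⟨p⟩ := hG.preconnected x y
  induction p with
  | nil => exact ⟨0, by rw [heat_zero_self]; exact one_pos⟩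
  | @cons u v w h p ih =>
    obtain ⟨d, hd⟩ := ih
    refine ⟨d + 1, ?_⟩
    rw [heat_succ, nbrMean]
    refine div_pos (hd.trans_le ?_) (Nat.cast_pos.2 ((G.degree_pos_iff_exists_adj u).2 ⟨v, h⟩))
    exact Finset.single_le_sum (f := fun z => heat G d z w) (fun z _ => heat_nonneg d z w)
      ((G.mem_neighborFinset u v).2 h)

/-- On a finite set of sources, the Green functions with targets `y` and `z` are comparable. -/
theorem exists_green_le_mul_target (hG : G.Connected) {s : Set V} (hs : s.Finite) (z : V) :
    ∃ K : ℝ, 0 ≤ K ∧ ∃ d : ℕ, ∀ y ∈ s, ∀ n x, green G n x y ≤ K * green G (n + d) x z := by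
  choose d hd using fun y => exists_heat_pos hG y z
  obtain ⟨D, hD⟩ := (hs.image d).bddAbove
  obtain ⟨K, hK⟩ := (hs.image fun y => (heat G (d y) y z)⁻¹).bddAbove
  refine ⟨max K 0, le_max_right _ _, D, fun y hy n x => ?_⟩
  have h1 := green_mul_heat_le (G := G) n (d y) x y z
  have h2 : (heat G (d y) y z)⁻¹ ≤ max K 0 := (hK (Set.mem_image_of_mem _ hy)).trans (le_max_left _ _)
  have h3 := green_mono (G := G) (Nat.add_le_add_left (hD (Set.mem_image_of_mem d hy)) n) x z
  rw [← le_div_iff₀ (hd y), div_eq_inv_mul] at h1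
  exact h1.trans (mul_le_mul h2 h3 (green_nonneg _ _ _) (le_max_right _ _))

/-- By connectedness z is reached from y in some fixed number of steps with positive probability,
and n steps are then left. Finiteness of `s` makes the constants uniform. -/
theorem exists_green_le_mul_source (hG : G.Connected) {s : Set V} (hs : s.Finite) (z : V) :
    ∃ K : ℝ, 0 ≤ K ∧ ∃ d : ℕ, ∀ y ∈ s, ∀ n, green G n z z ≤ K * green G (n + d) y z := by
  choose d hd using fun y => exists_heat_pos hG y z
  obtain ⟨D, hD⟩ := (hs.image d).bddAbove
  obtain ⟨K, hK⟩ := (hs.image fun y => (heat G (d y) y z)⁻¹).bddAbove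
  refine ⟨max K 0, le_max_right _ _, D, fun y hy n => ?_⟩
  have h1 := heat_mul_green_le (G := G) (d y) n y z z
  have h2 : (heat G (d y) y z)⁻¹ ≤ max K 0 := (hK (Set.mem_image_of_mem _ hy)).trans (le_max_left _ _)
  have h3 := green_mono (G := G)
    ((Nat.add_le_add_right (hD (Set.mem_image_of_mem d hy)) n).trans_eq (add_comm D n)) y z
  rw [mul_comm, ← le_div_iff₀ (hd y), div_eq_inv_mul] at h1
  exact h1.trans (mul_le_mul h2 h3 (green_nonneg _ _ _) (le_max_right _ _))

end Graph

/-! ### Heat kernel of the square lattice. -/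

section Lattice

/-- The transition probabilities of the simple random walk on `ℤ`, started at `0`. -/
noncomputable def lineHeat : ℕ → ℤ → ℝ
  | 0, u => if u = 0 then 1 else 0
  | n + 1, u => (lineHeat n (u + 1) + lineHeat n (u - 1)) / 2

theorem lineHeat_eq_zero_of_lt (n : ℕ) {u : ℤ} (h : u < -n) : lineHeat n u = 0 := by
  induction n generalizing u with
  | zero => rw [lineHeat, if_neg (by simpa using h.ne)]
  | succ n ih =>
    push_cast at h
    rw [lineHeat, ih (by omega), ih (by omega), add_zero, zero_div]

theorem lineHeat_eq_zero_of_odd (n : ℕ) {u : ℤ} (h : Odd (u + n)) : lineHeat n u = 0 := by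
  induction n generalizing u with
  | zero =>
    rw [lineHeat, if_neg]
    rintro rfl
    simp at h
  | succ n ih =>
    push_cast at h
    have h1 : Odd (u + 1 + n) := by convert h using 1; ring
    have h2 : Odd (u - 1 + n) := by
      obtain ⟨a, ha⟩ := h
      exact ⟨a - 1, by omega⟩
    rw [lineHeat, ih h1, ih h2, add_zero, zero_div]

theorem lineHeat_two_mul_sub (n j : ℕ) : lineHeat n (2 * j - n) = n.choose j / 2 ^ n := by
  induction n generalizing j with
  | zero => cases j <;> simp [lineHeat]; omega
  | succ n ih =>
    cases j with
    | zero =>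
      have h1 := ih 0
      have h2 := lineHeat_eq_zero_of_lt n (u := 2 * ((0 : ℕ) : ℤ) - (n + 1 : ℕ) - 1)
        (by push_cast; omega)
      rw [lineHeat, h2, show (2 * ((0 : ℕ) : ℤ) - (n + 1 : ℕ) + 1 : ℤ) = 2 * ((0 : ℕ) : ℤ) - n by
        push_cast; ring, h1]
      simp only [Nat.choose_zero_right, Nat.cast_one, add_zero, pow_succ]
      field_simp
    | succ j =>
      rw [lineHeat, show (2 * ((j + 1 : ℕ) : ℤ) - (n + 1 : ℕ) + 1 : ℤ) = 2 * ((j + 1 : ℕ) : ℤ) - n by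
        push_cast; ring, show (2 * ((j + 1 : ℕ) : ℤ) - (n + 1 : ℕ) - 1 : ℤ) = 2 * (j : ℤ) - n by
        push_cast; ring, ih, ih, Nat.choose_succ_succ, pow_succ]
      push_cast
      field_simp
      ring

/-- The squared central binomial probability is a reciprocal Wallis product, so Wallis's formula
supplies the constant π without Stirling. -/
theorem lineHeat_two_mul_zero_sq (n : ℕ) :
    lineHeat (2 * n) 0 ^ 2 = 1 / (Real.Wallis.W n * (2 * n + 1)) := by
  have h := lineHeat_two_mul_sub (2 * n) n
  rw [show (2 * (n : ℤ) - (2 * n : ℕ) : ℤ) = 0 by push_cast; ring] at h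
  rw [h, Real.Wallis.W_eq_factorial_ratio, Nat.cast_choose ℝ (by omega : n ≤ 2 * n),
    show 2 * n - n = n by omega]
  have h1 : (n.factorial : ℝ) ≠ 0 := by positivity
  have h2 : ((2 * n).factorial : ℝ) ≠ 0 := by positivity
  have h3 : (2 * (n : ℝ) + 1) ≠ 0 := by positivity
  field_simp
  ring

theorem squareLattice_adj_iff (x y : ℤ × ℤ) : squareLattice.Adj x y ↔
    y = (x.1 + 1, x.2) ∨ y = (x.1 - 1, x.2) ∨ y = (x.1, x.2 + 1) ∨ y = (x.1, x.2 - 1) := by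
  obtain ⟨a, b⟩ := x
  obtain ⟨c, d⟩ := y
  simp only [squareLattice, Prod.mk.injEq]
  constructor
  · intro h
    rcases abs_cases (a - c) with h1 | h1 <;> rcases abs_cases (b - d) with h2 | h2 <;> omega
  · rintro (⟨rfl, rfl⟩ | ⟨rfl, rfl⟩ | ⟨rfl, rfl⟩ | ⟨rfl, rfl⟩) <;> simp

/-- The four neighbours of a point of the square lattice. -/
def latticeNbrs (x : ℤ × ℤ) : Finset (ℤ × ℤ) :=
  {(x.1 + 1, x.2), (x.1 - 1, x.2), (x.1, x.2 + 1), (x.1, x.2 - 1)}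

instance : squareLattice.LocallyFinite := fun x =>
  Fintype.ofFinset (latticeNbrs x) fun y => by
    simp [latticeNbrs, squareLattice_adj_iff]

theorem squareLattice_neighborFinset (x : ℤ × ℤ) :
    squareLattice.neighborFinset x = latticeNbrs x := by
  ext y
  simp [latticeNbrs, squareLattice_adj_iff]

theorem sum_latticeNbrs (f : ℤ × ℤ → ℝ) (x : ℤ × ℤ) : ∑ y ∈ latticeNbrs x, f y =
    f (x.1 + 1, x.2) + f (x.1 - 1, x.2) + f (x.1, x.2 + 1) + f (x.1, x.2 - 1) := by
  unfold latticeNbrs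
  rw [Finset.sum_insert, Finset.sum_insert, Finset.sum_insert, Finset.sum_singleton]
  · ring
  all_goals
    simp only [Finset.mem_insert, Finset.mem_singleton, Prod.mk.injEq]
    omega

theorem squareLattice_degree (x : ℤ × ℤ) : squareLattice.degree x = 4 := by
  have h : ((latticeNbrs x).card : ℝ) = 4 := by
    rw [Finset.cast_card, sum_latticeNbrs]
    norm_num
  rw [← SimpleGraph.card_neighborFinset_eq_degree, squareLattice_neighborFinset]
  exact_mod_cast h

theorem squareLattice_degree_pos (x : ℤ × ℤ) : 0 < squareLattice.degree x := by
  rw [squareLattice_degree]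
  norm_num

theorem squareLattice_nbrMean (f : ℤ × ℤ → ℝ) (x : ℤ × ℤ) : nbrMean squareLattice f x =
    (f (x.1 + 1, x.2) + f (x.1 - 1, x.2) + f (x.1, x.2 + 1) + f (x.1, x.2 - 1)) / 4 := by
  rw [nbrMean, squareLattice_degree, squareLattice_neighborFinset, sum_latticeNbrs]
  norm_num

theorem squareLattice_connected : squareLattice.Connected := by
  have h1 : ∀ (b : ℤ) (a : ℤ), squareLattice.Reachable (0, b) (a, b) := by
    intro b a
    induction a using Int.induction_on with
    | zero => exact SimpleGraph.Reachable.refl _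
    | succ i ih => exact ih.trans ((squareLattice_adj_iff _ _).2 (by simp)).reachable
    | pred i ih => exact ih.trans ((squareLattice_adj_iff _ _).2 (by simp)).reachable
  have h2 : ∀ b : ℤ, squareLattice.Reachable (0, 0) (0, b) := by
    intro b
    induction b using Int.induction_on with
    | zero => exact SimpleGraph.Reachable.refl _
    | succ i ih => exact ih.trans ((squareLattice_adj_iff _ _).2 (by simp)).reachable
    | pred i ih => exact ih.trans ((squareLattice_adj_iff _ _).2 (by simp)).reachable
  have h3 : ∀ x : ℤ × ℤ, squareLattice.Reachable (0, 0) x := fun x => (h2 x.2).trans (h1 x.2 x.1)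
  exact ⟨fun x y => (h3 x).symm.trans (h3 y)⟩

/-- In the rotated coordinates x₁ + x₂ and x₁ − x₂ the planar walk is a pair of independent walks on
ℤ. -/
theorem squareLattice_heat (n : ℕ) (x y : ℤ × ℤ) : heat squareLattice n x y =
    lineHeat n (x.1 - y.1 + (x.2 - y.2)) * lineHeat n (x.1 - y.1 - (x.2 - y.2)) := by
  induction n generalizing x with
  | zero =>
    obtain ⟨a, b⟩ := x
    obtain ⟨c, d⟩ := y
    simp only [heat, lineHeat, Prod.mk.injEq, mul_ite, mul_one, mul_zero, ← ite_and]
    refine if_congr ?_ rfl rfl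
    omega
  | succ n ih =>
    rw [heat_succ, squareLattice_nbrMean]
    simp only [ih, lineHeat]
    generalize hu : x.1 - y.1 + (x.2 - y.2) = u
    generalize hv : x.1 - y.1 - (x.2 - y.2) = v
    rw [show x.1 + 1 - y.1 + (x.2 - y.2) = u + 1 by omega,
      show x.1 + 1 - y.1 - (x.2 - y.2) = v + 1 by omega,
      show x.1 - 1 - y.1 + (x.2 - y.2) = u - 1 by omega,
      show x.1 - 1 - y.1 - (x.2 - y.2) = v - 1 by omega,
      show x.1 - y.1 + (x.2 + 1 - y.2) = u + 1 by omega,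
      show x.1 - y.1 - (x.2 + 1 - y.2) = v - 1 by omega,
      show x.1 - y.1 + (x.2 - 1 - y.2) = u - 1 by omega,
      show x.1 - y.1 - (x.2 - 1 - y.2) = v + 1 by omega]
    ring

theorem squareLattice_heat_self (n : ℕ) (x : ℤ × ℤ) :
    heat squareLattice n x x = lineHeat n 0 ^ 2 := by
  rw [squareLattice_heat]
  simp [sq]

theorem squareLattice_heat_odd_self (n : ℕ) (x : ℤ × ℤ) :
    heat squareLattice (2 * n + 1) x x = 0 := by
  rw [squareLattice_heat_self, lineHeat_eq_zero_of_odd _ ⟨n, by push_cast; ring⟩]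
  simp

theorem squareLattice_heat_even_self (n : ℕ) (x : ℤ × ℤ) :
    heat squareLattice (2 * n) x x = 1 / (Real.Wallis.W n * (2 * n + 1)) := by
  rw [squareLattice_heat_self, lineHeat_two_mul_zero_sq]

theorem squareLattice_heat_self_le (n : ℕ) (x : ℤ × ℤ) :
    heat squareLattice n x x ≤ 2 / (n + 1) := by
  rcases n.even_or_odd' with ⟨k, rfl | rfl⟩
  · have hW : 1 / 2 ≤ Real.Wallis.W k := by
      refine le_trans ?_ (Real.Wallis.le_W k)
      have h1 : (1 : ℝ) / 2 ≤ (2 * k + 1) / (2 * k + 2) := by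
        rw [div_le_div_iff₀ (by norm_num) (by positivity)]
        have : (0 : ℝ) ≤ k := k.cast_nonneg
        linarith
      have h2 : (1 : ℝ) ≤ Real.pi / 2 := by linarith [Real.pi_gt_three]
      calc (1 : ℝ) / 2 = 1 / 2 * 1 := by ring
        _ ≤ _ := mul_le_mul h1 h2 zero_le_one (by positivity)
    rw [squareLattice_heat_even_self, div_le_div_iff₀ (by positivity) (by positivity)]
    push_cast
    nlinarith [(k.cast_nonneg : (0 : ℝ) ≤ k)]
  · rw [squareLattice_heat_odd_self]
    positivity

theorem squareLattice_green_comm (n : ℕ) (x y : ℤ × ℤ) :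
    green squareLattice n x y = green squareLattice n y x := by
  have h := degree_mul_green squareLattice_degree_pos n x y
  rw [squareLattice_degree, squareLattice_degree] at h
  exact mul_left_cancel₀ (by norm_num) h

theorem squareLattice_green_self (n : ℕ) (x y : ℤ × ℤ) :
    green squareLattice n x x = green squareLattice n y y := by
  simp only [green, squareLattice_heat_self]

/-! ### Square sums of the lattice Green function. -/

theorem sum_sum_heat_self_le (n : ℕ) (x : ℤ × ℤ) :
    ∑ i ∈ Finset.range n, ∑ j ∈ Finset.range n, heat squareLattice (i + j) x x ≤ 4 * n := by
  induction n with
  | zero => simp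
  | succ n ih =>
    rw [Finset.sum_range_succ]
    simp only [Finset.sum_range_succ, Finset.sum_add_distrib]
    have h1 : ∀ j, heat squareLattice (n + j) x x ≤ 2 / (n + 1) := fun j =>
      (squareLattice_heat_self_le _ _).trans (by gcongr; simp)
    have h2 : ∑ j ∈ Finset.range n, heat squareLattice (n + j) x x ≤ n * (2 / (n + 1)) := by
      refine (Finset.sum_le_sum fun j _ => h1 j).trans ?_
      simp
    have h3 : ∑ i ∈ Finset.range n, heat squareLattice (i + n) x x ≤ n * (2 / (n + 1)) := by
      simpa only [add_comm] using h2
    -- Enlarging the square of indices adds 2n + 1 terms, each at most 2/(n+1), for a total of 4 −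
    -- 2/(n+1).
    have h4 : (n : ℝ) * (2 / (n + 1)) + n * (2 / (n + 1)) + 2 / (n + 1) ≤ 4 := by
      rw [← sub_nonneg]
      have : (4 : ℝ) - (n * (2 / (n + 1)) + n * (2 / (n + 1)) + 2 / (n + 1)) = 2 / (n + 1) := by
        field_simp
        ring
      rw [this]
      positivity
    have h5 := h1 n
    push_cast
    linarith

/-- By symmetry the square is a sum of products of transitions from y to x and back;
Chapman–Kolmogorov sums these over x. -/
theorem hasSum_green_mul_green (n : ℕ) (y : ℤ × ℤ) :
    HasSum (fun x => green squareLattice n x y ^ 2)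
      (∑ i ∈ Finset.range (n + 1), ∑ j ∈ Finset.range (n + 1), heat squareLattice (i + j) y y) := by
  have h := hasSum_sum (s := Finset.range (n + 1)) fun i _ => hasSum_sum (s := Finset.range (n + 1))
    fun j _ => hasSum_heat_mul_heat (G := squareLattice) i j y y
  refine h.congr_fun fun x => ?_
  rw [sq]
  nth_rw 1 [squareLattice_green_comm]
  rw [green, green, Finset.sum_mul_sum]

theorem summable_sq_green (n : ℕ) (y : ℤ × ℤ) :
    Summable fun x => green squareLattice n x y ^ 2 := (hasSum_green_mul_green n y).summable

theorem tsum_sq_green_le (n : ℕ) (y : ℤ × ℤ) :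
    ∑' x, green squareLattice n x y ^ 2 ≤ 4 * (n + 1) := by
  rw [(hasSum_green_mul_green n y).tsum_eq]
  exact_mod_cast sum_sum_heat_self_le (n + 1) y

theorem hasSum_squareLattice_green (n : ℕ) (y : ℤ × ℤ) :
    HasSum (fun x => green squareLattice n x y) (n + 1) := by
  simp only [squareLattice_green_comm n _ y]
  exact hasSum_green squareLattice_degree_pos n y

/-! ### Logarithmic growth of the lattice Green function. -/

theorem squareLattice_green_self_eq_sum (n : ℕ) (x : ℤ × ℤ) : green squareLattice n x x =
    ∑ k ∈ Finset.range (n / 2 + 1), 1 / (Real.Wallis.W k * (2 * k + 1)) := by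
  have key : ∀ m, ∑ k ∈ Finset.range (2 * m), heat squareLattice k x x =
      ∑ k ∈ Finset.range m, 1 / (Real.Wallis.W k * (2 * k + 1)) := by
    intro m
    induction m with
    | zero => simp
    | succ m ih =>
      rw [Nat.mul_succ, Finset.sum_range_succ, Finset.sum_range_succ, ih, Finset.sum_range_succ,
        squareLattice_heat_odd_self, squareLattice_heat_even_self, add_zero]
  rcases n.even_or_odd' with ⟨k, rfl | rfl⟩
  · rw [green, Finset.sum_range_succ, key, squareLattice_heat_even_self,
      Nat.mul_div_cancel_left _ two_pos, Finset.sum_range_succ]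
  · rw [green, show 2 * k + 1 + 1 = 2 * (k + 1) by ring, key]
    congr 2
    omega

theorem tendsto_harmonic_div_log :
    Tendsto (fun n : ℕ => (∑ k ∈ Finset.range n, 1 / ((k : ℝ) + 1)) / Real.log n) atTop (𝓝 1) := by
  have hlog : Tendsto (fun n : ℕ => Real.log n) atTop atTop :=
    Real.tendsto_log_atTop.comp tendsto_natCast_atTop_atTop
  have h := (Real.tendsto_harmonic_sub_log.div_atTop hlog).add_const 1
  rw [zero_add] at h
  refine h.congr' ?_
  filter_upwards [hlog.eventually_gt_atTop 0] with n hn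
  rw [harmonic]
  push_cast
  simp only [one_div]
  field_simp
  ring

theorem tendsto_sum_wallis_div_log :
    Tendsto (fun n : ℕ => (∑ k ∈ Finset.range n, 1 / (Real.Wallis.W k * (2 * k + 1))) / Real.log n)
      atTop (𝓝 (1 / Real.pi)) := by
  set g : ℕ → ℝ := fun k => 1 / ((k : ℝ) + 1) with hg
  have hlog : Tendsto (fun n : ℕ => Real.log n) atTop atTop :=
    Real.tendsto_log_atTop.comp tendsto_natCast_atTop_atTop
  have hsum : Tendsto (fun n => ∑ i ∈ Finset.range n, g i) atTop atTop :=
    Real.tendsto_sum_range_one_div_nat_succ_atTop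
  -- W_k tends to π/2 and (2k+1)/(k+1) to 2, so each term is asymptotic to 1/(π(k+1)); divergence of
  -- the harmonic series carries this over to the partial sums.
  have hlim : Tendsto (fun k : ℕ => 1 / (Real.Wallis.W k * (2 * k + 1)) / g k) atTop
      (𝓝 (1 / Real.pi)) := by
    have h1 : Tendsto (fun k : ℕ => (2 : ℝ) - 1 / ((k : ℝ) + 1)) atTop (𝓝 2) := by
      simpa using tendsto_one_div_add_atTop_nhds_zero_nat.const_sub (2 : ℝ)
    have h2 := (Real.Wallis.tendsto_W_nhds_pi_div_two.mul h1).inv₀ (by positivity)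
    rw [show (Real.pi / 2 * 2)⁻¹ = 1 / Real.pi by rw [one_div]; congr 1; ring] at h2
    refine h2.congr fun k => ?_
    have := (Real.Wallis.W_pos k).ne'
    have h3 : (2 : ℝ) - 1 / ((k : ℝ) + 1) = (2 * k + 1) / (k + 1) := by
      field_simp
      ring
    rw [h3, hg]
    field_simp
  have ho : (fun k : ℕ => 1 / (Real.Wallis.W k * (2 * k + 1)) - 1 / Real.pi * g k) =o[atTop] g := by
    rw [Asymptotics.isLittleO_iff_tendsto' (Eventually.of_forall fun k hk => absurd hk (by positivity))]
    have h := hlim.sub_const (1 / Real.pi)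
    rw [sub_self] at h
    refine h.congr fun k => ?_
    have : g k ≠ 0 := by positivity
    rw [sub_div, mul_div_cancel_right₀ _ this]
  have h := (ho.sum_range (fun k => by positivity) hsum).tendsto_div_nhds_zero
  have h2 := (h.add_const (1 / Real.pi)).mul tendsto_harmonic_div_log
  rw [zero_add, mul_one] at h2
  refine h2.congr' ?_
  filter_upwards [hsum.eventually_gt_atTop 0, hlog.eventually_gt_atTop 0] with n hn hn'
  rw [Finset.sum_sub_distrib, ← Finset.mul_sum]
  change (_ / (∑ i ∈ Finset.range n, g i) + _) * ((∑ i ∈ Finset.range n, g i) / _) = _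
  field_simp
  ring

theorem tendsto_squareLattice_green_div_log (x : ℤ × ℤ) :
    Tendsto (fun n : ℕ => green squareLattice n x x / Real.log n) atTop (𝓝 (1 / Real.pi)) := by
  have hlog : Tendsto (fun n : ℕ => Real.log n) atTop atTop :=
    Real.tendsto_log_atTop.comp tendsto_natCast_atTop_atTop
  have hhalf : Tendsto (fun n : ℕ => n / 2 + 1) atTop atTop :=
    tendsto_atTop_mono (fun n => by omega : ∀ n, n / 2 ≤ n / 2 + 1)
      (Nat.tendsto_div_const_atTop two_ne_zero)
  have h1 := tendsto_sum_wallis_div_log.comp hhalf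
  have h2 : Tendsto (fun n : ℕ => Real.log (n / 2 + 1 : ℕ) / Real.log n) atTop (𝓝 1) := by
    have hl : Tendsto (fun n : ℕ => 1 - Real.log 2 / Real.log n) atTop (𝓝 1) := by
      simpa using (tendsto_const_nhds.div_atTop hlog).const_sub (1 : ℝ)
    refine tendsto_of_tendsto_of_tendsto_of_le_of_le' hl tendsto_const_nhds ?_ ?_
    · filter_upwards [eventually_gt_atTop 1] with n hn
      have hn0 : (0 : ℝ) < n := by positivity
      have hln : 0 < Real.log n := Real.log_pos (by exact_mod_cast hn)
      rw [one_sub_div hln.ne', ← Real.log_div hn0.ne' two_ne_zero]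
      gcongr
      rw [div_le_iff₀ two_pos]
      exact_mod_cast (by omega : n ≤ (n / 2 + 1) * 2)
    · filter_upwards [eventually_gt_atTop 1] with n hn
      have hln : 0 < Real.log n := Real.log_pos (by exact_mod_cast hn)
      rw [div_le_one hln]
      gcongr
      omega
  have h := h1.mul h2
  rw [mul_one] at h
  refine h.congr' ?_
  filter_upwards [(hlog.comp hhalf).eventually_gt_atTop 0] with n hn
  rw [squareLattice_green_self_eq_sum]
  exact div_mul_div_cancel₀ hn.ne'

end Lattice

/-! ### Maximum principles for two graphs that agree off a finite set. -/

section Overlap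

/-- Two graphs share the vertices parametrised by `E`, up to finitely many vertices of each, and
the neighbours of a shared vertex outside the finite set `A` are shared and agree. -/
structure Overlap {W V E : Type*} (Γ : SimpleGraph W) (G : SimpleGraph V) [Γ.LocallyFinite]
    [G.LocallyFinite] (i : E → W) (j : E → V) (A : Finset E) : Prop where
  injective_left : Function.Injective i
  injective_right : Function.Injective j
  finite_left : (Set.range i)ᶜ.Finite
  finite_right : (Set.range j)ᶜ.Finite
  nbrs : ∀ y ∉ A, ∃ s : Finset E, Γ.neighborFinset (i y) = s.map ⟨i, injective_left⟩ ∧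
    G.neighborFinset (j y) = s.map ⟨j, injective_right⟩

namespace Overlap

variable {W V E : Type*} {Γ : SimpleGraph W} {G : SimpleGraph V} [Γ.LocallyFinite]
  [G.LocallyFinite] {i : E → W} {j : E → V} {A : Finset E}

theorem exists_nbrMean_eq (h : Overlap Γ G i j A) {y : E} (hy : y ∉ A) : ∃ s : Finset E,
    (∀ f, nbrMean Γ f (i y) = (∑ z ∈ s, f (i z)) / s.card) ∧
      ∀ f, nbrMean G f (j y) = (∑ z ∈ s, f (j z)) / s.card := by
  obtain ⟨s, h1, h2⟩ := h.nbrs y hy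
  refine ⟨s, fun f => ?_, fun f => ?_⟩
  · rw [nbrMean, ← SimpleGraph.card_neighborFinset_eq_degree, h1, Finset.card_map, Finset.sum_map]
    rfl
  · rw [nbrMean, ← SimpleGraph.card_neighborFinset_eq_degree, h2, Finset.card_map, Finset.sum_map]
    rfl

theorem degree_eq (h : Overlap Γ G i j A) {y : E} (hy : y ∉ A) :
    G.degree (j y) = Γ.degree (i y) := by
  obtain ⟨s, h1, h2⟩ := h.nbrs y hy
  rw [← SimpleGraph.card_neighborFinset_eq_degree, ← SimpleGraph.card_neighborFinset_eq_degree,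
    h1, h2, Finset.card_map, Finset.card_map]

theorem heat_zero_eq (h : Overlap Γ G i j A) (x y : E) :
    heat G 0 (j y) (j x) = heat Γ 0 (i y) (i x) := by
  rcases eq_or_ne y x with rfl | hyx
  · rw [heat_zero_self, heat_zero_self]
  · rw [heat_zero_of_ne (h.injective_left.ne hyx), heat_zero_of_ne (h.injective_right.ne hyx)]

/-- As functions of the starting point, both Green functions have the same source term, and off A
the same averaging step. The source cancels in the difference, which is then controlled by its
values on A. -/
theorem abs_green_sub_green_le (h : Overlap Γ G i j A) (n : ℕ) (x y : E) :
    |green G n (j y) (j x) - green Γ n (i y) (i x)| ≤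
      ∑ a ∈ A, (green G n (j a) (j x) + green Γ n (i a) (i x)) := by
  have hnn : ∀ n, ∀ a ∈ A, 0 ≤ green G n (j a) (j x) + green Γ n (i a) (i x) := fun n a _ =>
    add_nonneg (green_nonneg _ _ _) (green_nonneg _ _ _)
  induction n generalizing y with
  | zero =>
    rw [green_zero, green_zero]
    rw [h.heat_zero_eq, sub_self, abs_zero]
    exact Finset.sum_nonneg (hnn 0)
  | succ n ih =>
    by_cases hy : y ∈ A
    · have h1 := Finset.single_le_sum (hnn (n + 1)) hy
      have h2 := green_nonneg (G := G) (n + 1) (j y) (j x)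
      have h3 := green_nonneg (G := Γ) (n + 1) (i y) (i x)
      refine le_trans ?_ h1
      rw [abs_le]
      constructor <;> linarith
    · obtain ⟨s, h1, h2⟩ := h.exists_nbrMean_eq hy
      rw [green_succ, green_succ, h.heat_zero_eq, h1, h2, add_sub_add_left_eq_sub, ← sub_div,
        ← Finset.sum_sub_distrib, abs_div, Nat.abs_cast]
      have hmono : ∑ a ∈ A, (green G n (j a) (j x) + green Γ n (i a) (i x)) ≤
          ∑ a ∈ A, (green G (n + 1) (j a) (j x) + green Γ (n + 1) (i a) (i x)) :=
        Finset.sum_le_sum fun a _ => add_le_add (green_mono n.le_succ _ _) (green_mono n.le_succ _ _)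
      refine le_trans ?_ hmono
      refine div_le_of_le_mul₀ (Nat.cast_nonneg _) (Finset.sum_nonneg (hnn n)) ?_
      refine (Finset.abs_sum_le_sum_abs _ _).trans ((Finset.sum_le_card_nsmul _ _ _
        fun z _ => ih z).trans_eq ?_)
      rw [nsmul_eq_mul, mul_comm]

/-- Off A the smaller side has no source, so domination on A propagates along the first-step
recursion. -/
theorem green_le_mul_green (h : Overlap Γ G i j A) {o : V} {w : W} (ho : ∀ y ∉ A, j y ≠ o)
    {C : ℝ} (hC : 0 ≤ C) {d : ℕ}
    (hA : ∀ n, ∀ a ∈ A, green G n (j a) o ≤ C * green Γ (n + d) (i a) w) (n : ℕ) (y : E) :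
    green G n (j y) o ≤ C * green Γ (n + d) (i y) w := by
  induction n generalizing y with
  | zero =>
    by_cases hy : y ∈ A
    · exact hA 0 y hy
    · rw [green_zero, heat_zero_of_ne (ho y hy)]
      exact mul_nonneg hC (green_nonneg _ _ _)
  | succ n ih =>
    by_cases hy : y ∈ A
    · exact hA _ y hy
    · obtain ⟨s, h1, h2⟩ := h.exists_nbrMean_eq hy
      rw [green_succ_of_ne n (ho y hy), Nat.add_right_comm]
      refine le_trans ?_ (mul_le_mul_of_nonneg_left (nbrMean_green_le _ _ _) hC)
      rw [h1, h2, ← mul_div_assoc, Finset.mul_sum]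
      gcongr with z
      exact ih z

/-- Here the comparison on A is known only for one pair of times n, N. Giving G the time N on top of
the k steps used to reach A makes that single comparison enough. -/
theorem mul_green_le_green (h : Overlap Γ G i j A) {o : V} {w : W} (hw : ∀ y ∉ A, i y ≠ w)
    {c : ℝ} (hc : 0 ≤ c) {n N : ℕ}
    (hA : ∀ a ∈ A, c * green Γ n (i a) w ≤ green G N (j a) o) {k : ℕ} (hk : k ≤ n) (y : E) :
    c * green Γ k (i y) w ≤ green G (N + k) (j y) o := by
  have hyA : ∀ k ≤ n, ∀ a ∈ A, c * green Γ k (i a) w ≤ green G (N + k) (j a) o := fun k hk a ha =>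
    (mul_le_mul_of_nonneg_left (green_mono hk _ _) hc).trans
      ((hA a ha).trans (green_mono (Nat.le_add_right N k) _ _))
  induction k generalizing y with
  | zero =>
    by_cases hy : y ∈ A
    · exact hyA 0 hk y hy
    · rw [green_zero, heat_zero_of_ne (hw y hy), mul_zero]
      exact green_nonneg _ _ _
  | succ k ih =>
    by_cases hy : y ∈ A
    · exact hyA _ hk y hy
    · obtain ⟨s, h1, h2⟩ := h.exists_nbrMean_eq hy
      rw [green_succ_of_ne k (hw y hy), ← Nat.add_assoc]
      refine le_trans ?_ (nbrMean_green_le _ _ _)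
      rw [h1, h2, ← mul_div_assoc, Finset.mul_sum]
      gcongr with z
      exact ih (by omega) z

end Overlap

theorem tsum_le_tsum_comp_add_sum {W E : Type*} {i : E → W} (hi : Function.Injective i)
    {F : Finset W} (hF : ∀ w, w ∉ Set.range i → w ∈ F) {f : W → ℝ} (hf : Summable f)
    (hf0 : ∀ w, 0 ≤ f w) : ∑' w, f w ≤ ∑' y, f (i y) + ∑ w ∈ F, f w := by
  rw [← tsum_range f hi, ← Finset.tsum_subtype' F f, tsum_subtype, tsum_subtype (F : Set W) f,
    ← (hf.indicator _).tsum_add (hf.indicator _)]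
  refine hf.tsum_le_tsum (fun w => ?_) ((hf.indicator _).add (hf.indicator _))
  by_cases hw : w ∈ Set.range i
  · rw [Set.indicator_of_mem hw]
    exact le_add_of_nonneg_right (Set.indicator_nonneg (fun _ _ => hf0 _) _)
  · rw [Set.indicator_of_mem (show w ∈ (F : Set W) from hF w hw)]
    exact le_add_of_nonneg_left (Set.indicator_nonneg (fun _ _ => hf0 _) _)

/-! ### Comparing the Green function of G with that of the lattice. -/

theorem tendsto_squareLattice_green_div_self (x : ℤ × ℤ) :
    Tendsto (fun n : ℕ => green squareLattice n x x / n) atTop (𝓝 0) := by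
  have h1 := (Real.tendsto_pow_log_div_mul_add_atTop 1 0 1 one_ne_zero).comp
    (tendsto_natCast_atTop_atTop (R := ℝ))
  have h2 := (tendsto_squareLattice_green_div_log x).mul h1
  rw [mul_zero] at h2
  refine h2.congr' ?_
  filter_upwards [eventually_gt_atTop 1] with n hn
  have : Real.log n ≠ 0 := (Real.log_pos (by exact_mod_cast hn)).ne'
  simp only [Function.comp_apply, pow_one, one_mul, add_zero]
  exact div_mul_div_cancel₀ this

namespace Overlap

variable {V E : Type*} {G : SimpleGraph V} [G.LocallyFinite] {i : E → ℤ × ℤ} {j : E → V}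
  {A : Finset E}

/-- Mass count: a multiple of the lattice Green function lies below that of G on the shared
vertices. Summing, the lattice side has mass n + 1 minus the finitely many unshared vertices, while
reversibility bounds the mass on the G side. -/
theorem green_self_mul_le (h : Overlap squareLattice G i j A) (hdeg : ∀ v, 0 < G.degree v)
    {o : V} (hA : ∀ y ∉ A, j y ≠ o ∧ i y ≠ 0) {K : ℝ} (hK : 0 < K) {d n : ℕ}
    (hKd : ∀ a ∈ A, green G n o o ≤ K * green G (n + d) (j a) o) :
    green G n o o * (n + 1 - h.finite_left.toFinset.card * green squareLattice n 0 0) ≤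
      K * green squareLattice n 0 0 * (G.degree o * (2 * n + d + 1)) := by
  set L := green squareLattice n 0 0
  have hL : 0 < L := green_self_pos _ _
  -- The largest multiple for which the hypothesis `hKd`, with the lattice function bounded by L,
  -- gives domination on A.
  set c := green G n o o / (K * L) with hcdef
  have hc : 0 ≤ c := div_nonneg (green_nonneg _ _ _) (by positivity)
  have hlow := h.mul_green_le_green (o := o) (w := 0) (fun y hy => (hA y hy).2) hc (n := n)
    (N := n + d) (fun a ha => by
      calc c * green squareLattice n (i a) 0 ≤ c * L :=
            mul_le_mul_of_nonneg_left (green_le_green_self _ _ _) hc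
        _ = green G n o o / K := by rw [hcdef]; field_simp
        _ ≤ _ := (div_le_iff₀' hK).2 (hKd a ha)) le_rfl
  have hsumG : Summable fun v => green G (n + d + n) v o := by
    refine Summable.of_nonneg_of_le (fun v => green_nonneg _ _ _)
      (fun v => green_le_degree_mul hdeg _ v o) ((hasSum_green hdeg _ o).summable.mul_left _)
  have hsum1 : ∑' v, green G (n + d + n) v o ≤ G.degree o * (2 * n + d + 1) := by
    refine (hsumG.tsum_le_tsum (fun v => green_le_degree_mul hdeg _ v o)
      ((hasSum_green hdeg _ o).summable.mul_left _)).trans_eq ?_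
    rw [tsum_mul_left, (hasSum_green hdeg _ o).tsum_eq]
    push_cast
    ring
  have hsum2 : ∑' y, green G (n + d + n) (j y) o ≤ ∑' v, green G (n + d + n) v o :=
    tsum_comp_le_tsum_of_inj hsumG (fun v => green_nonneg _ _ _) h.injective_right
  have hsumL := hasSum_squareLattice_green n 0
  have hsum3 := tsum_le_tsum_comp_add_sum h.injective_left (F := h.finite_left.toFinset)
    (fun w hw => by simpa using hw) hsumL.summable fun w => green_nonneg _ _ _
  rw [hsumL.tsum_eq] at hsum3
  have hsum4 : ∑ w ∈ h.finite_left.toFinset, green squareLattice n w 0 ≤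
      h.finite_left.toFinset.card * L := by
    rw [← nsmul_eq_mul]
    exact Finset.sum_le_card_nsmul _ _ _ fun w _ => green_le_green_self _ _ _
  have hsum5 : c * ∑' y, green squareLattice n (i y) 0 ≤ ∑' y, green G (n + d + n) (j y) o := by
    rw [← tsum_mul_left]
    exact ((hsumL.summable.comp_injective h.injective_left).mul_left c).tsum_le_tsum hlow
      (hsumG.comp_injective h.injective_right)
  have hfin : c * (n + 1 - h.finite_left.toFinset.card * L) ≤ G.degree o * (2 * n + d + 1) := by
    refine le_trans (mul_le_mul_of_nonneg_left ?_ hc) ((hsum5.trans hsum2).trans hsum1)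
    linarith
  calc green G n o o * (n + 1 - h.finite_left.toFinset.card * L)
      = K * L * (c * (n + 1 - h.finite_left.toFinset.card * L)) := by rw [hcdef]; field_simp
    _ ≤ _ := mul_le_mul_of_nonneg_left hfin (by positivity)

theorem exists_green_self_le (h : Overlap squareLattice G i j A) (hG : G.Connected)
    (hdeg : ∀ v, 0 < G.degree v) {o : V} (hA : ∀ y ∉ A, j y ≠ o ∧ i y ≠ 0) :
    ∃ C : ℝ, 0 ≤ C ∧ ∀ n, green G n o o ≤ C * green squareLattice n 0 0 := by
  obtain ⟨K, hK, d, hKd⟩ := exists_green_le_mul_source hG ((A.finite_toSet).image j) o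
  set F := (h.finite_left.toFinset.card : ℝ) with hF
  have hF0 : 0 ≤ F := Nat.cast_nonneg _
  -- This threshold makes the unshared mass F L at most n/2, so at least (n+1)/2 remains in the mass
  -- count. Times below N are covered by the trivial bound n + 1 ≤ N.
  have hev : ∀ᶠ n : ℕ in atTop, green squareLattice n 0 0 / n < 1 / (2 * (F + 1)) :=
    (tendsto_squareLattice_green_div_self 0).eventually_lt_const (by positivity)
  obtain ⟨N, hN⟩ := eventually_atTop.1 (hev.and (eventually_gt_atTop 0))
  set D : ℝ := 2 * (K + 1) * (G.degree o * (d + 2)) with hD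
  have hD0 : 0 ≤ D := by positivity
  refine ⟨D + N, by positivity, fun n => ?_⟩
  have hL : 1 ≤ green squareLattice n 0 0 := one_le_green_self _ _
  rcases lt_or_ge n N with hn | hn
  · have h1 : (n : ℝ) + 1 ≤ N := by exact_mod_cast hn
    have h2 : (N : ℝ) ≤ N * green squareLattice n 0 0 := le_mul_of_one_le_right (by positivity) hL
    have h3 := green_le (G := G) n o o
    have h4 : 0 ≤ D * green squareLattice n 0 0 := by positivity
    linarith
  · obtain ⟨hn1, hn0⟩ := hN n hn
    have hn0' : (0 : ℝ) < n := Nat.cast_pos.2 hn0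
    have h1 := h.green_self_mul_le hdeg hA (K := K + 1) (by positivity) (d := d) (n := n)
      fun a ha => (hKd (j a) ⟨a, ha, rfl⟩ n).trans
        (mul_le_mul_of_nonneg_right (by linarith) (green_nonneg _ _ _))
    rw [← hF] at h1
    set L := green squareLattice n 0 0
    rw [div_lt_div_iff₀ hn0' (by positivity)] at hn1
    have h2 : ((n : ℝ) + 1) / 2 ≤ n + 1 - F * L := by nlinarith
    have h3 := (mul_le_mul_of_nonneg_left h2 (green_nonneg (G := G) n o o)).trans h1
    have h4 : (K + 1) * L * (G.degree o * (2 * n + d + 1)) ≤ D * L * ((n + 1) / 2) := by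
      have h5 : (2 * n + d + 1 : ℝ) ≤ (d + 2) * (n + 1) := by
        nlinarith [mul_nonneg (d.cast_nonneg : (0 : ℝ) ≤ d) hn0'.le]
      calc (K + 1) * L * (G.degree o * (2 * n + d + 1))
          ≤ (K + 1) * L * (G.degree o * ((d + 2) * (n + 1))) := by gcongr
        _ = _ := by rw [hD]; ring
    have h6 := le_of_mul_le_mul_right (h3.trans h4) (by positivity)
    have h7 : 0 ≤ (N : ℝ) * L := by positivity
    linarith

theorem exists_degree_le (h : Overlap squareLattice G i j A) :
    ∃ Δ : ℕ, ∀ y, G.degree (j y) ≤ Δ := by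
  refine ⟨max 4 (A.sup fun a => G.degree (j a)), fun y => ?_⟩
  by_cases hy : y ∈ A
  · exact (Finset.le_sup (f := fun a => G.degree (j a)) hy).trans (le_max_right _ _)
  · rw [h.degree_eq hy, squareLattice_degree]
    exact le_max_left _ _

theorem exists_green_le (h : Overlap squareLattice G i j A) (hG : G.Connected)
    (hdeg : ∀ v, 0 < G.degree v) {o : V} (hA : ∀ y ∉ A, j y ≠ o ∧ i y ≠ 0) :
    ∃ C : ℝ, 0 ≤ C ∧ ∃ d : ℕ, ∀ n y,
      green G n (j y) o ≤ C * green squareLattice (n + d) (i y) 0 := by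
  obtain ⟨C, hC, hCL⟩ := h.exists_green_self_le hG hdeg hA
  obtain ⟨K, hK, d, hKd⟩ := exists_green_le_mul_source squareLattice_connected
    ((A.finite_toSet).image i) 0
  refine ⟨C * K, by positivity, d, h.green_le_mul_green (fun y hy => (hA y hy).1) (by positivity)
    fun n a ha => ?_⟩
  calc green G n (j a) o ≤ green G n o o := green_le_green_self _ _ _
    _ ≤ C * green squareLattice n 0 0 := hCL n
    _ ≤ C * (K * green squareLattice (n + d) (i a) 0) :=
        mul_le_mul_of_nonneg_left (hKd (i a) ⟨a, ha, rfl⟩ n) hC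
    _ = _ := by ring

/-- Reversibility, with degrees bounded on the shared vertices, turns the Green functions from A to
y into Green functions from y to A. Connectedness moves the target from A to o or 0, and
`exists_green_le` passes from G to the lattice. -/
theorem exists_comparison (h : Overlap squareLattice G i j A) (hG : G.Connected)
    (hdeg : ∀ v, 0 < G.degree v) {o : V} (hA : ∀ y ∉ A, j y ≠ o ∧ i y ≠ 0) :
    ∃ K : ℝ, 0 ≤ K ∧ ∃ d : ℕ, ∀ n y,
      |green G n (j y) (j y) - green squareLattice n 0 0| ≤
        K * green squareLattice (n + d) (i y) 0 ∧
      green G n o (j y) ≤ K * green squareLattice (n + d) (i y) 0 := by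
  obtain ⟨C, hC, d₁, hCd⟩ := h.exists_green_le hG hdeg hA
  obtain ⟨Δ, hΔ⟩ := h.exists_degree_le
  obtain ⟨K₁, hK₁, d₂, hKd₁⟩ := exists_green_le_mul_target hG ((A.finite_toSet).image j) o
  obtain ⟨K₂, hK₂, d₃, hKd₂⟩ := exists_green_le_mul_target squareLattice_connected
    ((A.finite_toSet).image i) 0
  have hrev : ∀ n (v : V) (y : E), green G n v (j y) ≤ Δ * green G n (j y) v := fun n v y =>
    (green_le_degree_mul hdeg n v (j y)).trans
      (mul_le_mul_of_nonneg_right (Nat.cast_le.2 (hΔ y)) (green_nonneg _ _ _))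
  have hK0 : 0 ≤ A.card * (Δ * (K₁ * C) + K₂) := by positivity
  have hΔC : 0 ≤ Δ * C := by positivity
  refine ⟨A.card * (Δ * (K₁ * C) + K₂) + Δ * C, by positivity, d₁ + d₂ + d₃, fun n y => ?_⟩
  set B := green squareLattice (n + (d₁ + d₂ + d₃)) (i y) 0
  have hB : 0 ≤ B := green_nonneg _ _ _
  have hmono : ∀ m ≤ n + (d₁ + d₂ + d₃), green squareLattice m (i y) 0 ≤ B := fun m hm =>
    green_mono hm _ _
  constructor
  · have hbound : ∀ a ∈ A, green G n (j a) (j y) + green squareLattice n (i a) (i y) ≤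
        (Δ * (K₁ * C) + K₂) * B := by
      intro a ha
      have h1 : green G n (j a) (j y) ≤ Δ * (K₁ * (C * B)) := by
        refine (hrev n _ y).trans ?_
        gcongr
        refine (hKd₁ (j a) ⟨a, ha, rfl⟩ n (j y)).trans ?_
        gcongr
        refine (hCd _ y).trans ?_
        gcongr
        exact hmono _ (by omega)
      have h2 : green squareLattice n (i a) (i y) ≤ K₂ * B := by
        rw [squareLattice_green_comm]
        refine (hKd₂ (i a) ⟨a, ha, rfl⟩ n (i y)).trans ?_
        gcongr
        exact hmono _ (by omega)
      linarith
    have h3 := h.abs_green_sub_green_le n y y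
    rw [squareLattice_green_self n (i y) 0] at h3
    refine h3.trans ((Finset.sum_le_card_nsmul _ _ _ hbound).trans ?_)
    rw [nsmul_eq_mul, ← mul_assoc]
    exact mul_le_mul_of_nonneg_right (le_add_of_nonneg_right hΔC) hB
  · calc green G n o (j y) ≤ Δ * green G n (j y) o := hrev n o y
      _ ≤ Δ * (C * B) := by
          gcongr
          refine (hCd n y).trans ?_
          gcongr
          exact hmono _ (by omega)
      _ = Δ * C * B := by ring
      _ ≤ _ := mul_le_mul_of_nonneg_right (le_add_of_nonneg_left hK0) hB

theorem exists_green_le_of_finite (h : Overlap squareLattice G i j A) (hG : G.Connected)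
    (hdeg : ∀ v, 0 < G.degree v) {o : V} (hA : ∀ y ∉ A, j y ≠ o ∧ i y ≠ 0) {s : Set V}
    (hs : s.Finite) : ∃ K : ℝ, 0 ≤ K ∧ ∃ d : ℕ, ∀ n, ∀ v ∈ s,
      green G n o v ≤ K * green squareLattice (n + d) 0 0 := by
  obtain ⟨C, hC, hCL⟩ := h.exists_green_self_le hG hdeg hA
  obtain ⟨K, hK, d, hKd⟩ := exists_green_le_mul_target hG hs o
  refine ⟨K * C, by positivity, d, fun n v hv => ?_⟩
  rw [mul_assoc]
  exact (hKd v hv n o).trans (mul_le_mul_of_nonneg_left (hCL _) hK)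

end Overlap

end Overlap

/-! ### From the law of the walk to hitting probabilities. -/

section Walk

variable {V : Type*} {G : SimpleGraph V} [G.LocallyFinite]

theorem tsum_stepProb_mul (x : V) {f : V → ℝ} (hf : ∀ z, 0 ≤ f z) (hx : 0 < G.degree x) :
    ∑' z, stepProb G x z * ENNReal.ofReal (f z) = ENNReal.ofReal (nbrMean G f x) := by
  have h0 : ∀ z ∉ G.neighborFinset x, stepProb G x z * ENNReal.ofReal (f z) = 0 := by
    intro z hz
    rw [stepProb, if_neg (by simpa using hz), zero_mul]
  rw [tsum_eq_sum h0, nbrMean, div_eq_inv_mul, ENNReal.ofReal_mul (by positivity),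
    ENNReal.ofReal_sum_of_nonneg fun z _ => hf z, Finset.mul_sum,
    ENNReal.ofReal_inv_of_pos (Nat.cast_pos.2 hx), ENNReal.ofReal_natCast]
  refine Finset.sum_congr rfl fun z hz => ?_
  rw [stepProb, if_pos (by simpa using hz)]

theorem walkRange_eq_tsum {V Ω : Type*} (S : ℕ → Ω → V) (n : ℕ) (ω : Ω) : (walkRange S n ω : ℝ≥0∞) =
    ∑' y, Set.indicator {ω | ∃ j ≤ n, S j ω = y} (fun _ => (1 : ℝ≥0∞)) ω := by
  have hfin : ((fun i => S i ω) '' Set.Iic n).Finite := (Set.finite_Iic n).image _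
  have h : ∀ y, Set.indicator {ω | ∃ j ≤ n, S j ω = y} (fun _ => (1 : ℝ≥0∞)) ω =
      Set.indicator ((fun i => S i ω) '' Set.Iic n) (fun _ => (1 : ℝ≥0∞)) y := by
    intro y
    by_cases hy : ∃ j ≤ n, S j ω = y
    · have hy' : y ∈ (fun i => S i ω) '' Set.Iic n := hy
      rw [Set.indicator_of_mem hy', Set.indicator_of_mem (s := {ω | ∃ j ≤ n, S j ω = y}) hy]
    · have hy' : y ∉ (fun i => S i ω) '' Set.Iic n := hy
      rw [Set.indicator_of_notMem hy', Set.indicator_of_notMem (s := {ω | ∃ j ≤ n, S j ω = y}) hy]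
  rw [tsum_congr h, walkRange, ← tsum_subtype ((fun i => S i ω) '' Set.Iic n) fun _ => (1 : ℝ≥0∞),
    ENNReal.tsum_set_one, ← hfin.cast_ncard_eq]
  rfl

variable {o : V} {Ω : Type*} [MeasurableSpace Ω] {P : Measure Ω} {S : ℕ → Ω → V}

namespace IsSimpleRandomWalk

theorem measurableSet_preimage (hS : IsSimpleRandomWalk G o P S) (n : ℕ) (s : Set V) :
    MeasurableSet {ω | S n ω ∈ s} := by
  let _ : MeasurableSpace V := ⊤
  exact hS.measurable n (MeasurableSpace.measurableSet_top (s := s))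

theorem measurableSet_path (hS : IsSimpleRandomWalk G o P S) (n : ℕ) (x : ℕ → V) :
    MeasurableSet {ω | ∀ i ≤ n, S i ω = x i} := by
  simp only [Set.ofPred_forall]
  exact MeasurableSet.iInter fun i => MeasurableSet.iInter fun _ =>
    hS.measurableSet_preimage i {x i}

theorem measurableSet_avoid (hS : IsSimpleRandomWalk G o P S) (n k : ℕ) (y : V) :
    MeasurableSet {ω | ∀ j ≤ k, S (n + j) ω ≠ y} := by
  simp only [Set.ofPred_forall]
  exact MeasurableSet.iInter fun j => MeasurableSet.iInter fun _ =>
    hS.measurableSet_preimage (n + j) {y}ᶜ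

/-- Markov property for avoiding y: the whole past is kept, since the walk is specified by
conditioning on full trajectories. Both n and x vary in the induction because each step lengthens
the past. -/
theorem measure_path_avoid [Countable V] (hG : ∀ v, 0 < G.degree v)
    (hS : IsSimpleRandomWalk G o P S) (y : V) (k n : ℕ) (x : ℕ → V) :
    P ({ω | ∀ i ≤ n, S i ω = x i} ∩ {ω | ∀ j ≤ k, S (n + j) ω ≠ y}) =
      P {ω | ∀ i ≤ n, S i ω = x i} * ENNReal.ofReal (1 - hitProb G k (x n) y) := by
  induction k generalizing n x with
  | zero =>
    by_cases h : x n = y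
    · rw [← h, hitProb_self, sub_self, ENNReal.ofReal_zero, mul_zero]
      refine measure_mono_null ?_ measure_empty
      rintro ω ⟨h1, h2⟩
      exact h2 0 le_rfl (h1 n le_rfl)
    · rw [hitProb_zero_of_ne h, sub_zero, ENNReal.ofReal_one, mul_one]
      congr 1
      refine Set.inter_eq_left.2 fun ω hω j hj => ?_
      obtain rfl : j = 0 := by omega
      rw [add_zero, hω n le_rfl]
      exact h
  | succ k ih =>
    by_cases h : x n = y
    · rw [← h, hitProb_self, sub_self, ENNReal.ofReal_zero, mul_zero]
      refine measure_mono_null ?_ measure_empty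
      rintro ω ⟨h1, h2⟩
      exact h2 0 (Nat.zero_le _) (h1 n le_rfl)
    · classical
      -- Updating x at n + 1 encodes a past with one more step, to z; the event is then partitioned
      -- by z.
      have hpath : ∀ z, {ω | ∀ i ≤ n + 1, S i ω = Function.update x (n + 1) z i} =
          {ω | (∀ i ≤ n, S i ω = x i) ∧ S (n + 1) ω = z} := by
        intro z
        ext ω
        constructor
        · intro hω
          refine ⟨fun i hi => ?_, ?_⟩
          · rw [hω i (by omega), Function.update_of_ne (by omega)]
          · rw [hω (n + 1) le_rfl, Function.update_self]
        · rintro ⟨h1, h2⟩ i hi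
          rcases Nat.le_succ_iff.1 hi with hi | rfl
          · rw [h1 i hi, Function.update_of_ne (by omega)]
          · rw [h2, Function.update_self]
      have hunion : {ω | ∀ i ≤ n, S i ω = x i} ∩ {ω | ∀ j ≤ k + 1, S (n + j) ω ≠ y} =
          ⋃ z, ({ω | ∀ i ≤ n + 1, S i ω = Function.update x (n + 1) z i} ∩
            {ω | ∀ j ≤ k, S (n + 1 + j) ω ≠ y}) := by
        ext ω
        simp only [Set.mem_iUnion, hpath]
        constructor
        · rintro ⟨h1, h2⟩
          refine ⟨S (n + 1) ω, ⟨h1, rfl⟩, fun j hj => ?_⟩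
          rw [add_assoc, add_comm 1 j]
          exact h2 (j + 1) (by omega)
        · rintro ⟨z, ⟨h1, -⟩, h2⟩
          refine ⟨h1, fun j hj => ?_⟩
          cases j with
          | zero =>
            rw [add_zero, h1 n le_rfl]
            exact h
          | succ j =>
            rw [add_comm j 1, ← add_assoc]
            exact h2 j (by omega)
      have hdisj : Pairwise (Function.onFun Disjoint fun z =>
          {ω | ∀ i ≤ n + 1, S i ω = Function.update x (n + 1) z i} ∩
            {ω | ∀ j ≤ k, S (n + 1 + j) ω ≠ y}) := by
        intro z z' hz
        refine Set.disjoint_left.2 fun ω hω hω' => hz ?_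
        have h1 := hω.1 (n + 1) le_rfl
        have h2 := hω'.1 (n + 1) le_rfl
        rw [Function.update_self] at h1 h2
        exact h1.symm.trans h2
      rw [hunion, measure_iUnion hdisj fun z =>
        (hS.measurableSet_path _ _).inter (hS.measurableSet_avoid _ _ _)]
      simp only [ih]
      simp only [hpath, hS.markov, Function.update_self, mul_assoc]
      rw [ENNReal.tsum_mul_left,
        tsum_stepProb_mul (x n) (fun z => sub_nonneg.2 (hitProb_le_one k z y)) (hG _),
        hitProb_succ_of_ne k h]
      have h1 := nbrMean_add (G := G) (fun z => 1 - hitProb G k z y) (fun z => hitProb G k z y) (x n)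
      simp only [sub_add_cancel, nbrMean_const (hG _)] at h1
      rw [eq_sub_of_add_eq h1.symm]

theorem measure_avoid [Countable V] [IsProbabilityMeasure P] (hG : ∀ v, 0 < G.degree v)
    (hS : IsSimpleRandomWalk G o P S) (n : ℕ) (y : V) :
    P {ω | ∀ j ≤ n, S j ω ≠ y} = ENNReal.ofReal (1 - hitProb G n o y) := by
  have h := hS.measure_path_avoid hG y n 0 fun _ => o
  have hstart : {ω | ∀ i ≤ 0, S i ω = o} = {ω | S 0 ω = o} := by simp
  have hae : ∀ᵐ ω ∂P, S 0 ω = o := by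
    exact (prob_compl_eq_zero_iff (hS.measurableSet_preimage 0 {o})).2 hS.start
  rw [hstart, hS.start, one_mul] at h
  rw [← h]
  refine measure_congr ?_
  filter_upwards [hae] with ω hω
  refine propext ?_
  change (∀ j ≤ n, S j ω ≠ y) ↔ (S 0 ω = o ∧ ∀ j ≤ n, S (0 + j) ω ≠ y)
  simp [hω]

theorem measure_visit [Countable V] [IsProbabilityMeasure P] (hG : ∀ v, 0 < G.degree v)
    (hS : IsSimpleRandomWalk G o P S) (n : ℕ) (y : V) :
    P {ω | ∃ j ≤ n, S j ω = y} = ENNReal.ofReal (hitProb G n o y) := by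
  have hm : MeasurableSet {ω | ∀ j ≤ n, S j ω ≠ y} := by
    simpa using hS.measurableSet_avoid 0 n y
  have hc : {ω | ∃ j ≤ n, S j ω = y} = {ω | ∀ j ≤ n, S j ω ≠ y}ᶜ := by
    ext ω
    simp
  rw [hc, prob_compl_eq_one_sub hm, hS.measure_avoid hG, ← ENNReal.ofReal_one,
    ← ENNReal.ofReal_sub _ (sub_nonneg.2 (hitProb_le_one _ _ _)), sub_sub_cancel]

/-- The expected range is the sum over all vertices of the probability of being visited. -/
theorem integral_walkRange [Countable V] [IsProbabilityMeasure P] (hG : ∀ v, 0 < G.degree v)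
    (hS : IsSimpleRandomWalk G o P S) (n : ℕ) :
    ∫ ω, (walkRange S n ω : ℝ) ∂P = ∑' y, hitProb G n o y := by
  have hm : ∀ y, MeasurableSet {ω | ∃ j ≤ n, S j ω = y} := by
    intro y
    simp only [Set.ofPred_exists]
    exact MeasurableSet.iUnion fun j => (MeasurableSet.const _).inter
      (hS.measurableSet_preimage j {y})
  have hmeas : Measurable fun ω => (walkRange S n ω : ℝ≥0∞) := by
    simp only [walkRange_eq_tsum S]
    exact Measurable.tsum fun y => measurable_const.indicator (hm y)
  have h1 : ∀ ω, (walkRange S n ω : ℝ) = ((walkRange S n ω : ℝ≥0∞)).toReal := fun ω => by simp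
  simp only [h1]
  rw [integral_toReal hmeas.aemeasurable (Eventually.of_forall fun ω => ENNReal.natCast_lt_top _)]
  simp only [walkRange_eq_tsum S]
  rw [lintegral_tsum fun y => (measurable_const.indicator (hm y)).aemeasurable]
  simp only [lintegral_indicator_const (hm _), one_mul, hS.measure_visit hG]
  rw [← ENNReal.ofReal_tsum_of_nonneg (fun y => hitProb_nonneg n o y)
    ((hasSum_green hG n o).summable.of_nonneg_of_le (fun y => hitProb_nonneg n o y)
      fun y => hitProb_le_green n o y),
    ENNReal.toReal_ofReal (tsum_nonneg fun y => hitProb_nonneg n o y)]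

end IsSimpleRandomWalk

end Walk

/-! ### Two-sided bounds for the sum of hitting probabilities. -/

section Range

theorem exists_overlap {V : Type*} {G : SimpleGraph V} [G.LocallyFinite]
    (hmod : IsFiniteModification G squareLattice) (o : V) :
    ∃ (E : Type) (i : E → ℤ × ℤ) (j : E → V) (A : Finset E), Overlap squareLattice G i j A ∧
      ∀ y ∉ A, j y ≠ o ∧ i y ≠ 0 := by
  classical
  obtain ⟨D, D', hD, hD', ⟨e⟩⟩ := hmod
  let i : ↥Dᶜ → ℤ × ℤ := Subtype.val
  let j : ↥Dᶜ → V := fun y => (e y : V)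
  have hi : Function.Injective i := Subtype.val_injective
  have hj : Function.Injective j := Subtype.val_injective.comp e.injective
  have hri : Set.range i = Dᶜ := Subtype.range_val
  have hrj : Set.range j = D'ᶜ := by
    ext v
    constructor
    · rintro ⟨y, rfl⟩
      exact (e y).2
    · intro hv
      exact ⟨e.symm ⟨v, hv⟩, by simp [j]⟩
  have hadj : ∀ y z, G.Adj (j y) (j z) ↔ squareLattice.Adj (i y) (i z) := fun y z =>
    e.map_rel_iff (a := y) (b := z)
  have hA1 : (i ⁻¹' ⋃ d ∈ D, squareLattice.neighborSet d).Finite :=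
    (hD.biUnion fun d _ => Set.toFinite _).preimage hi.injOn
  have hA2 : (j ⁻¹' ⋃ d ∈ D', G.neighborSet d).Finite :=
    (hD'.biUnion fun d _ => Set.toFinite _).preimage hj.injOn
  have hA3 : (j ⁻¹' {o}).Finite := (Set.finite_singleton o).preimage hj.injOn
  have hA4 : (i ⁻¹' {0}).Finite := (Set.finite_singleton 0).preimage hi.injOn
  -- A collects the shared vertices adjacent to a deleted vertex in either graph, together with
  -- those representing o or 0; o itself may be unshared.
  refine ⟨↥Dᶜ, i, j, ((hA1.union hA2).union (hA3.union hA4)).toFinset, ⟨hi, hj, ?_, ?_, ?_⟩, ?_⟩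
  · rwa [hri, compl_compl]
  · rwa [hrj, compl_compl]
  · intro y hy
    simp only [Set.Finite.mem_toFinset, Set.mem_union, Set.mem_preimage, Set.mem_iUnion,
      SimpleGraph.mem_neighborSet, not_or, not_exists] at hy
    refine ⟨(squareLattice.neighborFinset (i y)).preimage i hi.injOn, ?_, ?_⟩
    · ext z
      simp only [Finset.mem_map, Finset.mem_preimage, SimpleGraph.mem_neighborFinset,
        Function.Embedding.coeFn_mk]
      constructor
      · intro hz
        obtain ⟨x, rfl⟩ : z ∈ Set.range i := by
          rw [hri]
          exact fun hzD => hy.1.1 z hzD hz.symm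
        exact ⟨x, hz, rfl⟩
      · rintro ⟨x, hx, rfl⟩
        exact hx
    · ext z
      simp only [Finset.mem_map, Finset.mem_preimage, SimpleGraph.mem_neighborFinset,
        Function.Embedding.coeFn_mk]
      constructor
      · intro hz
        obtain ⟨x, rfl⟩ : z ∈ Set.range j := by
          rw [hrj]
          exact fun hzD => hy.1.2 z hzD hz.symm
        exact ⟨x, (hadj y x).1 hz, rfl⟩
      · rintro ⟨x, hx, rfl⟩
        exact (hadj y x).2 hx
  · intro y hy
    simp only [Set.Finite.mem_toFinset, Set.mem_union, Set.mem_preimage, Set.mem_singleton_iff,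
      not_or] at hy
    exact hy.2

namespace Overlap

variable {V E : Type*} {G : SimpleGraph V} [G.LocallyFinite] {i : E → ℤ × ℤ} {j : E → V}
  {A : Finset E}

theorem countable (h : Overlap squareLattice G i j A) : Countable V := by
  have : Countable E := h.injective_left.countable
  rw [← Set.countable_univ_iff, ← Set.union_compl_self (Set.range j)]
  exact (Set.countable_range j).union h.finite_right.countable

theorem infinite (h : Overlap squareLattice G i j A) : Infinite V := by
  have : Infinite E := by
    by_contra hE
    rw [not_infinite_iff_finite] at hE
    have := (Set.finite_range i).union h.finite_left
    rw [Set.union_compl_self] at this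
    exact Set.infinite_univ this
  exact Infinite.of_injective j h.injective_right

theorem degree_pos (h : Overlap squareLattice G i j A) (hG : G.Connected) (v : V) :
    0 < G.degree v := by
  have := h.infinite
  exact hG.preconnected.degree_pos_of_nontrivial v

theorem tsum_sq_green_comp_le (h : Overlap squareLattice G i j A) (n : ℕ) :
    ∑' y, green squareLattice n (i y) 0 ^ 2 ≤ 4 * (n + 1) :=
  (tsum_comp_le_tsum_of_inj (summable_sq_green n 0) (fun _ => sq_nonneg _)
    h.injective_left).trans (tsum_sq_green_le n 0)

end Overlap

/-- Replaces the diagonal value g by L at quadratic cost. If κ ≤ L/2 then g ≥ L/2, so p ≤ 2κ/L and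
the error pκ/L is at most 2κ²/L². Otherwise 4κ²/L² exceeds 1 ≥ p, so vertices near the modification
need no separate treatment. -/
theorem le_of_mul_le_of_sub_le {p w g L κ : ℝ} (hp0 : 0 ≤ p) (hp1 : p ≤ 1) (hL : 0 < L)
    (hκ : 0 ≤ κ) (hpg : p * g ≤ w) (hg : L - κ ≤ g) (hw0 : 0 ≤ w) (hw : w ≤ κ) :
    p ≤ w / L + 4 * κ ^ 2 / L ^ 2 := by
  rcases le_or_gt κ (L / 2) with h | h
  · have h1 : p * (L / 2) ≤ κ := (mul_le_mul_of_nonneg_left (by linarith) hp0).trans (hpg.trans hw)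
    have h2 : p * L ≤ w + p * κ := by nlinarith [mul_le_mul_of_nonneg_left hg hp0]
    have h3 : p * κ * L ≤ 2 * κ ^ 2 := by nlinarith [mul_le_mul_of_nonneg_right h1 hκ]
    rw [div_add_div _ _ hL.ne' (by positivity), le_div_iff₀ (by positivity)]
    nlinarith [mul_le_mul_of_nonneg_right h2 (sq_nonneg L), mul_le_mul_of_nonneg_right h3 hL.le,
      mul_nonneg (sq_nonneg κ) hL.le]
  · have h1 : 1 ≤ 4 * κ ^ 2 / L ^ 2 := by
      rw [one_le_div (by positivity)]
      nlinarith
    exact hp1.trans (h1.trans (le_add_of_nonneg_left (by positivity)))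

/-- Only p < w/L needs an argument; then p ≤ κ/L, so the error pκ/L is at most κ²/L². -/
theorem sub_le_of_le_mul {p w g L κ : ℝ} (hp0 : 0 ≤ p) (hL : 0 < L) (hκ : 0 ≤ κ)
    (hpg : w ≤ p * g) (hg : g ≤ L + κ) (hw : w ≤ κ) :
    w / L - κ ^ 2 / L ^ 2 ≤ p := by
  rcases le_or_gt (w / L) p with h | h
  · have : 0 ≤ κ ^ 2 / L ^ 2 := by positivity
    linarith
  · have h1 : p * L ≤ κ := ((lt_div_iff₀ hL).1 h).le.trans hw
    have h2 : w ≤ p * L + p * κ := by nlinarith [mul_le_mul_of_nonneg_left hg hp0]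
    have h3 : p * κ * L ≤ κ ^ 2 := by nlinarith [mul_le_mul_of_nonneg_right h1 hκ]
    rw [div_sub_div _ _ hL.ne' (by positivity), div_le_iff₀ (by positivity)]
    nlinarith [mul_le_mul_of_nonneg_right h2 (sq_nonneg L), mul_le_mul_of_nonneg_right h3 hL.le]

namespace Overlap

variable {V E : Type*} {G : SimpleGraph V} [G.LocallyFinite] {i : E → ℤ × ℤ} {j : E → V}
  {A : Finset E}

theorem summable_hitProb (hdeg : ∀ v, 0 < G.degree v) (n : ℕ) (o : V) :
    Summable fun y => hitProb G n o y :=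
  (hasSum_green hdeg n o).summable.of_nonneg_of_le (fun y => hitProb_nonneg n o y)
    fun y => hitProb_le_green n o y

theorem exists_tsum_hitProb_le (h : Overlap squareLattice G i j A) (hG : G.Connected)
    (hdeg : ∀ v, 0 < G.degree v) {o : V} (hA : ∀ y ∉ A, j y ≠ o ∧ i y ≠ 0) :
    ∃ C c c' : ℝ, ∀ n m : ℕ, ∑' y, hitProb G n o y ≤
      c' + (n + (m + 1)) / green squareLattice m 0 0 +
        C * (n + (m + c)) / green squareLattice m 0 0 ^ 2 := by
  obtain ⟨K, hK, d, hKd⟩ := h.exists_comparison hG hdeg hA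
  refine ⟨16 * K ^ 2, d + 1, h.finite_right.toFinset.card, fun n m => ?_⟩
  set L := green squareLattice m 0 0
  have hL : 0 < L := green_self_pos _ _
  -- One time for both uses of the comparison: the diagonal at time m and the visits from o at time
  -- n + m.
  set B : E → ℝ := fun y => green squareLattice (n + m + d) (i y) 0 with hB
  have hB0 : ∀ y, 0 ≤ B y := fun y => green_nonneg _ _ _
  have hBsum : Summable fun y => B y ^ 2 :=
    (summable_sq_green (n + m + d) 0).comp_injective h.injective_left
  have hwsum := (hasSum_green hdeg (n + m) o).summable
  have hpt : ∀ y, hitProb G n o (j y) ≤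
      green G (n + m) o (j y) / L + 4 * K ^ 2 / L ^ 2 * B y ^ 2 := by
    intro y
    have h1 : K * green squareLattice (m + d) (i y) 0 ≤ K * B y :=
      mul_le_mul_of_nonneg_left (green_mono (by omega) _ _) hK
    have h2 := (abs_le.1 (hKd m y).1).1
    refine (le_of_mul_le_of_sub_le (hitProb_nonneg n o (j y)) (hitProb_le_one n o (j y)) hL
      (mul_nonneg hK (hB0 y)) (hitProb_mul_green_le n m o (j y)) (by linarith)
      (green_nonneg _ _ _) (hKd (n + m) y).2).trans_eq ?_
    ring
  have hsum1 := (summable_hitProb hdeg n o).comp_injective h.injective_right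
  have hsum2 : Summable fun y => green G (n + m) o (j y) / L :=
    (hwsum.comp_injective h.injective_right).div_const L
  have hsum3 := hBsum.mul_left (4 * K ^ 2 / L ^ 2)
  have h1 := hsum1.tsum_le_tsum hpt (hsum2.add hsum3)
  rw [hsum2.tsum_add hsum3, tsum_mul_left] at h1
  have h2 : ∑' y, (green G (n + m) o (j y)) / L ≤ (n + (m + 1)) / L := by
    rw [tsum_div_const]
    gcongr
    refine (tsum_comp_le_tsum_of_inj hwsum (fun _ => green_nonneg _ _ _)
      h.injective_right).trans_eq ?_
    rw [(hasSum_green hdeg (n + m) o).tsum_eq]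
    push_cast
    ring
  have h3 : 4 * K ^ 2 / L ^ 2 * ∑' y, B y ^ 2 ≤ 16 * K ^ 2 * (n + (m + (d + 1))) / L ^ 2 := by
    refine (mul_le_mul_of_nonneg_left (h.tsum_sq_green_comp_le (n + m + d))
      (by positivity)).trans_eq ?_
    push_cast
    ring
  have h4 := tsum_le_tsum_comp_add_sum h.injective_right (F := h.finite_right.toFinset)
    (fun w hw => by simpa using hw) (summable_hitProb hdeg n o) fun v => hitProb_nonneg n o v
  have h5 : ∑ v ∈ h.finite_right.toFinset, hitProb G n o v ≤ h.finite_right.toFinset.card := by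
    refine (Finset.sum_le_card_nsmul _ _ 1 fun v _ => hitProb_le_one n o v).trans_eq ?_
    rw [nsmul_eq_mul, mul_one]
  linarith

theorem exists_le_tsum_hitProb (h : Overlap squareLattice G i j A) (hG : G.Connected)
    (hdeg : ∀ v, 0 < G.degree v) {o : V} (hA : ∀ y ∉ A, j y ≠ o ∧ i y ≠ 0) :
    ∃ (C c K : ℝ) (d : ℕ), ∀ n : ℕ,
      (n + 1 - K * green squareLattice (n + d) 0 0) / green squareLattice n 0 0 -
        C * (n + c) / green squareLattice n 0 0 ^ 2 ≤ ∑' y, hitProb G n o y := by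
  obtain ⟨K, hK, d, hKd⟩ := h.exists_comparison hG hdeg hA
  obtain ⟨K', hK', d', hKd'⟩ := h.exists_green_le_of_finite hG hdeg hA h.finite_right
  refine ⟨4 * K ^ 2, d + 1, h.finite_right.toFinset.card * K', d', fun n => ?_⟩
  set L := green squareLattice n 0 0 with hLdef
  have hL : 0 < L := green_self_pos _ _
  set B : E → ℝ := fun y => green squareLattice (n + d) (i y) 0 with hB
  have hBsum : Summable fun y => B y ^ 2 :=
    (summable_sq_green (n + d) 0).comp_injective h.injective_left
  have hwsum := (hasSum_green hdeg n o).summable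
  have hpt : ∀ y, green G n o (j y) / L - K ^ 2 / L ^ 2 * B y ^ 2 ≤ hitProb G n o (j y) := by
    intro y
    have h2 := (abs_le.1 (hKd n y).1).2
    refine le_of_eq_of_le ?_ (sub_le_of_le_mul (hitProb_nonneg n o (j y)) hL
      (mul_nonneg hK (green_nonneg _ _ _)) (green_le_hitProb_mul n o (j y)) (by linarith)
      (hKd n y).2)
    ring
  have hsum1 := (summable_hitProb hdeg n o).comp_injective h.injective_right
  have hsum2 : Summable fun y => green G n o (j y) / L :=
    (hwsum.comp_injective h.injective_right).div_const L
  have hsum3 := hBsum.mul_left (K ^ 2 / L ^ 2)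
  have h1 := (hsum2.sub hsum3).tsum_le_tsum hpt hsum1
  rw [hsum2.tsum_sub hsum3, tsum_mul_left] at h1
  have h2 := tsum_le_tsum_comp_add_sum h.injective_right (F := h.finite_right.toFinset)
    (fun w hw => by simpa using hw) hwsum fun v => green_nonneg n o v
  have h3 : ∑ v ∈ h.finite_right.toFinset, green G n o v ≤
      h.finite_right.toFinset.card * K' * green squareLattice (n + d') 0 0 := by
    refine (Finset.sum_le_card_nsmul _ _ _ fun v hv => hKd' n v ?_).trans_eq ?_
    · simpa using hv
    · rw [nsmul_eq_mul, mul_assoc]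
  rw [(hasSum_green hdeg n o).tsum_eq] at h2
  have h4 : (n + 1 - h.finite_right.toFinset.card * K' * green squareLattice (n + d') 0 0) / L ≤
      ∑' y, green G n o (j y) / L := by
    rw [tsum_div_const]
    gcongr
    linarith
  have h5 : K ^ 2 / L ^ 2 * ∑' y, B y ^ 2 ≤ 4 * K ^ 2 * (n + (d + 1)) / L ^ 2 := by
    refine (mul_le_mul_of_nonneg_left (h.tsum_sq_green_comp_le (n + d))
      (by positivity)).trans_eq ?_
    push_cast
    ring
  have h6 : ∑' y, hitProb G n o (j y) ≤ ∑' v, hitProb G n o v :=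
    tsum_comp_le_tsum_of_inj (summable_hitProb hdeg n o) (fun v => hitProb_nonneg n o v)
      h.injective_right
  linarith

end Overlap

/-! ### Asymptotics and the squeeze. -/

theorem tendsto_log_div_squareLattice_green :
    Tendsto (fun n : ℕ => Real.log n / green squareLattice n 0 0) atTop (𝓝 Real.pi) := by
  have h := (tendsto_squareLattice_green_div_log 0).inv₀ (by positivity)
  simpa using h

theorem tendsto_squareLattice_green_atTop :
    Tendsto (fun n : ℕ => green squareLattice n 0 0) atTop atTop := by
  have hlog : Tendsto (fun n : ℕ => Real.log n) atTop atTop :=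
    Real.tendsto_log_atTop.comp tendsto_natCast_atTop_atTop
  refine ((tendsto_squareLattice_green_div_log 0).pos_mul_atTop (by positivity) hlog).congr' ?_
  filter_upwards [hlog.eventually_gt_atTop 0] with n hn
  exact div_mul_cancel₀ _ hn.ne'

theorem tendsto_log_div_self : Tendsto (fun n : ℕ => Real.log n / n) atTop (𝓝 0) := by
  have h := (Real.tendsto_pow_log_div_mul_add_atTop 1 0 1 one_ne_zero).comp
    (tendsto_natCast_atTop_atTop (R := ℝ))
  simpa [Function.comp_def] using h

/-- A time scale `m n = o(n)` with `log (m n) ~ log n`. -/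
theorem exists_tendsto_div_log : ∃ m : ℕ → ℕ, Tendsto m atTop atTop ∧
    Tendsto (fun n : ℕ => (m n : ℝ) / n) atTop (𝓝 0) ∧
    Tendsto (fun n : ℕ => Real.log n / Real.log (m n)) atTop (𝓝 1) := by
  have hlog : Tendsto (fun n : ℕ => Real.log n) atTop atTop :=
    Real.tendsto_log_atTop.comp tendsto_natCast_atTop_atTop
  have hquot : Tendsto (fun n : ℕ => (n : ℝ) / Real.log n) atTop atTop := by
    have h1 : Tendsto (fun n : ℕ => Real.log n / n) atTop (𝓝[>] 0) := by
      refine tendsto_nhdsWithin_iff.2 ⟨tendsto_log_div_self, ?_⟩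
      filter_upwards [hlog.eventually_gt_atTop 0, eventually_gt_atTop 0] with n hn hn'
      exact div_pos hn (Nat.cast_pos.2 hn')
    exact h1.inv_tendsto_nhdsGT_zero.congr fun n => inv_div _ _
  -- Dividing by log n makes the scale o(n) but changes its logarithm only by about log log n =
  -- o(log n).
  refine ⟨fun n => ⌊(n : ℝ) / Real.log n⌋₊, tendsto_nat_floor_atTop.comp hquot, ?_, ?_⟩
  · refine squeeze_zero' (Eventually.of_forall fun n => by positivity) ?_ hlog.inv_tendsto_atTop
    filter_upwards [hlog.eventually_gt_atTop 0, eventually_gt_atTop 0] with n hn hn'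
    have hn0 : (0 : ℝ) < n := Nat.cast_pos.2 hn'
    rw [div_le_iff₀ hn0, Pi.inv_apply, inv_mul_eq_div]
    exact Nat.floor_le (by positivity)
  · have hll : Tendsto (fun n : ℕ => Real.log (Real.log n) / Real.log n) atTop (𝓝 0) :=
      (Real.isLittleO_log_id_atTop.tendsto_div_nhds_zero).comp hlog
    have hl2 : Tendsto (fun n : ℕ => Real.log 2 / Real.log n) atTop (𝓝 0) :=
      tendsto_const_nhds.div_atTop hlog
    have hlow := (hl2.const_sub 1).sub hll
    rw [sub_zero, sub_zero] at hlow
    have h : Tendsto (fun n : ℕ => Real.log ⌊(n : ℝ) / Real.log n⌋₊ / Real.log n) atTop (𝓝 1) := by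
      refine tendsto_of_tendsto_of_tendsto_of_le_of_le' hlow tendsto_const_nhds ?_ ?_
      · filter_upwards [hlog.eventually_ge_atTop 1, hquot.eventually_ge_atTop 2,
          eventually_gt_atTop 0] with n hn hq hn'
        have hn0 : (0 : ℝ) < n := Nat.cast_pos.2 hn'
        have hl : 0 < Real.log n := one_pos.trans_le hn
        have h1 : (n : ℝ) / Real.log n / 2 ≤ ⌊(n : ℝ) / Real.log n⌋₊ := by
          linarith [Nat.lt_floor_add_one ((n : ℝ) / Real.log n)]
        have h2 := Real.log_le_log (by positivity) h1
        rw [Real.log_div (by positivity) two_ne_zero, Real.log_div hn0.ne' hl.ne'] at h2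
        rw [le_div_iff₀ hl, sub_mul, sub_mul, div_mul_cancel₀ _ hl.ne', div_mul_cancel₀ _ hl.ne']
        linarith
      · filter_upwards [hlog.eventually_ge_atTop 1, hquot.eventually_ge_atTop 2,
          eventually_gt_atTop 0] with n hn hq hn'
        have hl : 0 < Real.log n := one_pos.trans_le hn
        have h1 : 0 < ⌊(n : ℝ) / Real.log n⌋₊ := Nat.floor_pos.2 (by linarith)
        rw [div_le_one hl]
        refine Real.log_le_log (Nat.cast_pos.2 h1) ((Nat.floor_le (by positivity)).trans ?_)
        exact div_le_self (Nat.cast_nonneg _) hn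
    have hinv := h.inv₀ one_ne_zero
    rw [inv_one] at hinv
    exact hinv.congr fun n => inv_div _ _

theorem tendsto_add_const_div (c : ℝ) :
    Tendsto (fun n : ℕ => ((n : ℝ) + c) / n) atTop (𝓝 1) := by
  have h := (tendsto_const_div_atTop_nhds_zero_nat c).const_add 1
  rw [add_zero] at h
  refine h.congr' ?_
  filter_upwards [eventually_gt_atTop 0] with n hn
  have : (n : ℝ) ≠ 0 := by positivity
  field_simp

theorem Overlap.tendsto_tsum_hitProb {V E : Type*} {G : SimpleGraph V} [G.LocallyFinite]
    {i : E → ℤ × ℤ} {j : E → V} {A : Finset E} (h : Overlap squareLattice G i j A)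
    (hG : G.Connected) (hdeg : ∀ v, 0 < G.degree v) {o : V}
    (hA : ∀ y ∉ A, j y ≠ o ∧ i y ≠ 0) :
    Tendsto (fun n : ℕ => Real.log n / n * ∑' y, hitProb G n o y) atTop (𝓝 Real.pi) := by
  obtain ⟨C₁, c₁, c₃, hup⟩ := h.exists_tsum_hitProb_le hG hdeg hA
  obtain ⟨C₂, c₂, K, d, hlow⟩ := h.exists_le_tsum_hitProb hG hdeg hA
  obtain ⟨m, hm, hmn, hmlog⟩ := exists_tendsto_div_log
  have hlog0 : ∀ n : ℕ, 0 ≤ Real.log n / n := fun n =>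
    div_nonneg (Real.log_natCast_nonneg n) n.cast_nonneg
  have hLpos : ∀ n, 0 < green squareLattice n 0 0 := fun n => green_self_pos n 0
  have hinv := tendsto_squareLattice_green_atTop.inv_tendsto_atTop
  have hlow' : Tendsto (fun n : ℕ => Real.log n / n *
      ((n + 1 - K * green squareLattice (n + d) 0 0) / green squareLattice n 0 0 -
        C₂ * (n + c₂) / green squareLattice n 0 0 ^ 2)) atTop (𝓝 Real.pi) := by
    have h1 := ((tendsto_squareLattice_green_div_self 0).comp (tendsto_add_atTop_nat d)).mul
      (tendsto_add_const_div d)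
    have h2 := (tendsto_add_const_div 1).sub (h1.const_mul K)
    have h3 := (tendsto_log_div_squareLattice_green.mul h2).sub
      (((tendsto_log_div_squareLattice_green.mul hinv).mul (tendsto_add_const_div c₂)).const_mul C₂)
    simp only [mul_zero, sub_zero, mul_one] at h3
    refine h3.congr' ?_
    filter_upwards [eventually_gt_atTop 0] with n hn
    have hn' : (n : ℝ) ≠ 0 := by positivity
    have hnd : (n : ℝ) + d ≠ 0 := by positivity
    have hL := (hLpos n).ne'
    simp only [Function.comp_apply, Pi.inv_apply, Nat.cast_add]
    field_simp
  have hup' : Tendsto (fun n : ℕ => Real.log n / n *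
      (c₃ + (n + (m n + 1)) / green squareLattice (m n) 0 0 +
        C₁ * (n + (m n + c₁)) / green squareLattice (m n) 0 0 ^ 2)) atTop (𝓝 Real.pi) := by
    have h0 : Tendsto (fun n : ℕ => Real.log n / green squareLattice (m n) 0 0) atTop
        (𝓝 Real.pi) := by
      have h1 := hmlog.mul (tendsto_log_div_squareLattice_green.comp hm)
      rw [one_mul] at h1
      refine h1.congr' ?_
      have hlog : Tendsto (fun n : ℕ => Real.log n) atTop atTop :=
        Real.tendsto_log_atTop.comp tendsto_natCast_atTop_atTop
      filter_upwards [(hlog.comp hm).eventually_gt_atTop 0] with n hn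
      exact div_mul_div_cancel₀ hn.ne'
    have h1 : ∀ c, Tendsto (fun n : ℕ => ((n : ℝ) + c) / n + m n / n) atTop (𝓝 1) := fun c => by
      simpa using (tendsto_add_const_div c).add hmn
    -- The three summands are the unshared vertices, the main term, and the quadratic error; the
    -- last keeps a spare factor 1/L and vanishes.
    have h3 := ((tendsto_log_div_self.const_mul c₃).add (h0.mul (h1 1))).add
      (((h0.mul (hinv.comp hm)).mul (h1 c₁)).const_mul C₁)
    simp only [mul_zero, add_zero, zero_add, mul_one] at h3
    refine h3.congr' ?_
    filter_upwards [eventually_gt_atTop 0] with n hn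
    have hn' : (n : ℝ) ≠ 0 := by positivity
    have hL := (hLpos (m n)).ne'
    simp only [Function.comp_apply, Pi.inv_apply]
    field_simp
    ring
  exact tendsto_of_tendsto_of_tendsto_of_le_of_le hlow' hup'
    (fun n => mul_le_mul_of_nonneg_left (hlow n) (hlog0 n))
    (fun n => mul_le_mul_of_nonneg_left (hup n (m n)) (hlog0 n))

end Range

theorem mainTheorem5 {V : Type*} (G : SimpleGraph V) [G.LocallyFinite]
    (hconn : G.Connected) (hmod : IsFiniteModification G squareLattice) (o : V)
    {Ω : Type*} [MeasurableSpace Ω] (P : Measure Ω) [IsProbabilityMeasure P]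
    (S : ℕ → Ω → V) (hS : IsSimpleRandomWalk G o P S) :
    Tendsto (fun n : ℕ => Real.log n / n * ∫ ω, (walkRange S n ω : ℝ) ∂P) atTop (𝓝 Real.pi) := by
  obtain ⟨E, i, j, A, h, hA⟩ := exists_overlap hmod o
  have := h.countable
  have hdeg := h.degree_pos hconn
  simp only [hS.integral_walkRange hdeg]
  exact h.tendsto_tsum_hitProb hconn hdeg hA
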